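/- **Theorem 2 (Robust feasibility condition for AC optimal power flow).** *Grid.* Consider a power grid with buses $k=1,\dots,n_b$, one of which is the reference bus, generators $i=1,\dots,n_g$, uncontrollable injections (loads) $1,\dots,n_d$ and lines $l=1,\dots,n_l$, each joining a from bus to a different to bus. Let $C_g,C_d$ be the $0/1$ connection matrices of generators and loads, and $E_f,E_t\in\mathbb R^{n_b\times n_l}$ the $0/1$ matrices of from and to buses, $E=E_f-E_t$. PV buses are the buses with a generator, PQ buses the others; subscripts pv, pq, ns select the rows of PV, PQ, non-reference buses. Line $l$ has two-port admittances $Y_{ff,l},Y_{ft,l},Y_{tf,l},Y_{tt,l}\in\mathbb C$, and bus $k$ a shunt admittance $Y_{sh,k}$; write $Y=G+\mathrm jB$, with line admittances read as diagonal matrices. Put $G^c=E_fG_{ft}+E_tG_{tf}$, $G^s=E_fG_{ft}-E_tG_{tf}$, $B^c=E_fB_{ft}+E_tB_{tf}$, $B^s=E_fB_{ft}-E_tB_{tf}$, and let $G^d,B^d$ be the diagonal matrices of the real and imaginary parts of $\sum_{l\text{ from }k}Y_{ff,l}+\sum_{l\text{ to }k}Y_{tt,l}+Y_{sh,k}$.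 Participation factors $\alpha_i\ge 0$ and limits $p_g^{\min},p_g^{\max}$, $q_g^{\min}\le q_g^{\max}$, $v^{\min},v^{\max}$, $\varphi^{\min},\varphi^{\max}$, $s^{\max}$ are given. *Variables.* The dispatch is $u=(p_{g,\mathrm{ref}},v_g)$ ($v_g$ the voltages at PV buses), the internal state $x=(\theta_{ns},v_{pq},\Delta)$, the uncertainty $w=(p_d,q_d)$; $\theta=0$ at the reference bus, $\varphi_l=\theta^f_l-\theta^t_l$, $p_{g,i}=p_{g,\mathrm{ref},i}+\alpha_i\Delta$, and $z=(\varphi,v_{pq},\Delta)=Ax$ with $A=\mathrm{blkdiag}(E_{ns}^T,I,1)$. The basis functions are $\psi(x,u)=\big((p_{g,i})_i,(v^f_lv^t_l\cos\varphi_l)_l,(v^f_lv^t_l\sin\varphi_l)_l,(v_k^2)_k\big)$. Let $$M=\begin{bmatrix}C_g&-G^c&-B^s&-G^d\\0&B^c_{pq}&-G^s_{pq}&B^d_{pq}\end{bmatrix},\quad R=-\begin{bmatrix}C_d&0\\0&C_{d,pq}\end{bmatrix},\quad L_q=\begin{bmatrix}0&-B^c_{pv}&G^s_{pv}&-B^d_{pv}\end{bmatrix},$$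 $$\begin{bmatrix}L^f_{p,\mathrm{line}}\\L^f_{q,\mathrm{line}}\\L^t_{p,\mathrm{line}}\\L^t_{q,\mathrm{line}}\end{bmatrix}=\begin{bmatrix}0&G_{ft}&B_{ft}&G_{ff}E_f^T\\0&-B_{ft}&G_{ft}&-B_{ff}E_f^T\\0&G_{tf}&-B_{tf}&G_{tt}E_t^T\\0&-B_{tf}&-G_{tf}&-B_{tt}E_t^T\end{bmatrix},$$ and let the line flows be $s_j^k=L^k_{j,\mathrm{line}}\psi(x,u)$ for $k\in\{f,t\}$, $j\in\{p,q\}$. The uncertainty set is $\mathcal W(\gamma)=\{w:(w-w^{(0)})^T\Sigma^{-1}(w-w^{(0)})\le\gamma^2\}$ with $\gamma\ge0$, $\Sigma$ positive definite, $\Sigma=\Sigma^{1/2}(\Sigma^{1/2})^T$; $\Sigma_q^{1/2}$ denotes the rows of $\Sigma^{1/2}$ that belong to $q_d$. *Robust feasibility.* $u$ is robustly feasible with respect to $\mathcal W(\gamma)$ if for every $w\in\mathcal W(\gamma)$ there are an internal state $x$ and reactive generations $q_g$ that satisfy, for every bus $k$, the AC power flow equations $$(C_gp_g-C_dp_d)_k=\sum_l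 v^f_lv^t_l(G^c_{kl}\cos\varphi_l+B^s_{kl}\sin\varphi_l)+G^d_{kk}v_k^2,$$ $$(C_gq_g-C_dq_d)_k=\sum_l v^f_lv^t_l(G^s_{kl}\sin\varphi_l-B^c_{kl}\cos\varphi_l)-B^d_{kk}v_k^2,$$ and the operational constraints $p_g^{\min}\le p_g\le p_g^{\max}$, $q_g^{\min}\le q_g\le q_g^{\max}$, $v^{\min}\le v\le v^{\max}$, $\varphi^{\min}\le\varphi\le\varphi^{\max}$, $(s^k_{p,l})^2+(s^k_{q,l})^2\le(s_l^{\max})^2$ for $k\in\{f,t\}$ and all $l$. *Envelopes.* Fix a nominal point $(x^{(0)},u^{(0)})$ at which the Jacobian $J_f=\nabla_x(M\psi(x,u)+Rw)$ is non-singular, let $J_\psi=\nabla_x\psi$ there, and put $g(x,u)=\psi(x,u)-J_\psi x$ and $K=-AJ_f^{-1}M$. Fix envelopes of $g$ and of $\psi$: for each component a convex upper and a concave lower bounding function, in the arguments $(p_{g,\mathrm{ref},i},\Delta)$, $(v^f_l,v^t_l,\varphi_l)$, $(v^f_l,v^t_l,\varphi_l)$, $v_k$ for the four blocks, that bound the component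 from above and below whenever, respectively, $p_{g,i}$; $v^f_l,v^t_l,\varphi_l$; $v_k$ are within their limits. For a matrix $L$ let $L^+_{ij}=\max\{L_{ij},0\}$, $L^-_{ij}=\min\{L_{ij},0\}$. *Condition.* Consider the following constraints on $u$, $\gamma$ and bounds $z^\ell=(\varphi^\ell,v_{pq}^\ell,\Delta^\ell)\le z^u=(\varphi^u,v_{pq}^u,\Delta^u)$, $g_{\mathcal P}^\ell,g_{\mathcal P}^u$, $\psi_{\mathcal P}^\ell,\psi_{\mathcal P}^u$, $q_g^\ell,q_g^u$, $s_j^{k,u}$: 1. at all vertices ($\Delta\in\{\Delta^\ell,\Delta^u\}$, $\varphi_l\in\{\varphi_l^\ell,\varphi_l^u\}$, $v\in\{v^\ell,v^u\}$ at PQ buses, independently for the two ends of a line, and $v=v_g$ at PV buses) the upper envelopes of $g$ are $\le g_{\mathcal P}^u$ and the lower ones $\ge g_{\mathcal P}^\ell$, and likewise for $\psi$ with $\psi_{\mathcal P}^u,\psi_{\mathcal P}^\ell$; 2. $K^+g^u_{\mathcal P}+K^-g^\ell_{\mathcal P}+\xi^u(\gamma)\le z^u$ and $K^+g^\ell_{\mathcal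 P}+K^-g^u_{\mathcal P}+\xi^\ell(\gamma)\ge z^\ell$, where $\xi_i^{u/\ell}(\gamma)=-A_iJ_f^{-1}Rw^{(0)}\pm\gamma\|A_iJ_f^{-1}R\Sigma^{1/2}\|_2$; 3. $p_{g,i}^{\min}\le p_{g,\mathrm{ref},i}+\alpha_i\Delta^\ell$, $p_{g,\mathrm{ref},i}+\alpha_i\Delta^u\le p_{g,i}^{\max}$, $q_g^{\min}\le q_g^\ell$, $q_g^u\le q_g^{\max}$, $v_{pq}^{\min}\le v_{pq}^\ell$, $v_{pq}^u\le v_{pq}^{\max}$, $v^{\min}\le v_g\le v^{\max}$ at PV buses, $\varphi^{\min}\le\varphi^\ell$, $\varphi^u\le\varphi^{\max}$, $(s_{p,l}^{k,u})^2+(s_{q,l}^{k,u})^2\le(s_l^{\max})^2$ for $k\in\{f,t\}$; 4. $L_q^+\psi^u_{\mathcal P}+L_q^-\psi^\ell_{\mathcal P}+\zeta^u(\gamma)\le C_{g,pv}q_g^u$ and $L_q^-\psi^u_{\mathcal P}+L_q^+\psi^\ell_{\mathcal P}+\zeta^\ell(\gamma)\ge C_{g,pv}q_g^\ell$, where $\zeta_i^{u/\ell}(\gamma)=C_{d,pv,i}\,q_d^{(0)}\pm\gamma\|C_{d,pv,i}\Sigma_q^{1/2}\|_2$;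 5. $L^{k,+}_{j,\mathrm{line}}\psi^u_{\mathcal P}+L^{k,-}_{j,\mathrm{line}}\psi^\ell_{\mathcal P}\le s_j^{k,u}$ and $-L^{k,-}_{j,\mathrm{line}}\psi^u_{\mathcal P}-L^{k,+}_{j,\mathrm{line}}\psi^\ell_{\mathcal P}\le s_j^{k,u}$ for $k\in\{f,t\}$, $j\in\{p,q\}$. *Claim.* (a) If for given $u$ and $\gamma\ge0$ there are bounds that satisfy this condition, then $u$ is robustly feasible with respect to $\mathcal W(\gamma)$. (b) The condition is a finite system of constraints $F_c\le0$ with functions $F_c$ that are convex in all decision variables ($u$, the bounds and $\gamma$) jointly; if the envelopes are quadratic, then all $F_c$ are (convex) quadratic functions. -/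

import Mathlib

open Matrix

noncomputable section

/-- A power grid with `nb` buses, `ng` generators, `nd` uncontrollable injections (loads) and `nl`
lines. Each line is a two-port with admittances `Yff, Yft, Ytf, Ytt`, i.e. the current entering
it at the from bus is `Yff * Vf + Yft * Vt` and at the to bus `Ytf * Vf + Ytt * Vt`; `Ysh` are bus
shunt admittances; `α` are the participation factors of the distributed slack. -/
structure PowerNetwork (nb ng nd nl : ℕ) where
  ref : Fin nb
  src : Fin nl → Fin nb
  tgt : Fin nl → Fin nb
  src_ne_tgt : ∀ l, src l ≠ tgt l
  genBus : Fin ng → Fin nb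
  loadBus : Fin nd → Fin nb
  Yff : Fin nl → ℂ
  Yft : Fin nl → ℂ
  Ytf : Fin nl → ℂ
  Ytt : Fin nl → ℂ
  Ysh : Fin nb → ℂ
  α : Fin ng → ℝ
  α_nonneg : ∀ i, 0 ≤ α i
  pMin : Fin ng → ℝ
  pMax : Fin ng → ℝ
  qMin : Fin ng → ℝ
  qMax : Fin ng → ℝ
  qMin_le_qMax : ∀ i, qMin i ≤ qMax i
  vMin : Fin nb → ℝ
  vMax : Fin nb → ℝ
  phiMin : Fin nl → ℝ
  phiMax : Fin nl → ℝ
  sMax : Fin nl → ℝ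

/-- The four kinds of line flow: active / reactive power entering a line at its from / to bus. -/
inductive FlowKind where
  | pf
  | qf
  | pt
  | qt

/-- Entrywise positive part `max {K_ij, 0}`. -/
def posEntries {m n : Type*} (K : Matrix m n ℝ) : Matrix m n ℝ := fun i j => max (K i j) 0

/-- Entrywise negative part `min {K_ij, 0}`. -/
def negEntries {m n : Type*} (K : Matrix m n ℝ) : Matrix m n ℝ := fun i j => min (K i j) 0

/-- The Euclidean norm of the `i`-th row of a matrix. -/
def rowNorm {m n : Type*} [Fintype n] (B : Matrix m n ℝ) (i : m) : ℝ :=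
  ‖(WithLp.toLp 2 (fun j => B i j) : EuclideanSpace ℝ n)‖

/-- A (possibly degenerate) quadratic function on a real vector space. -/
def IsQuadraticFun {E : Type*} [AddCommGroup E] [Module ℝ E] (f : E → ℝ) : Prop :=
  ∃ (Q : QuadraticForm ℝ E) (L : E →ₗ[ℝ] ℝ) (c : ℝ), ∀ x, f x = Q x + L x + c

/-- Indices of the uncertain vector `w = (p_d, q_d)`. -/
abbrev UncIdx (nd : ℕ) := Fin nd ⊕ Fin nd

/-- The confidence ellipsoid `W(γ)`. -/
def ellipsoid {nd : ℕ} (w0 : UncIdx nd → ℝ) (Sig : Matrix (UncIdx nd) (UncIdx nd) ℝ) (γ : ℝ) :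
    Set (UncIdx nd → ℝ) :=
  {w | (w - w0) ⬝ᵥ (Sig⁻¹ *ᵥ (w - w0)) ≤ γ ^ 2}

/-- Indices of the basis functions `ψ = (ψ^p, ψ^cos, ψ^sin, ψ^quad)`. -/
abbrev BasisIdx (nb ng nl : ℕ) := Fin ng ⊕ Fin nl ⊕ Fin nl ⊕ Fin nb

/-- Lower and upper bounding functions for a vector of functions indexed like `ψ`: the `p` part in
the arguments `(p_ref, Δ)`, the `cos` and `sin` parts in `(v^f, v^t, φ)`, the last part in `v`. -/
structure Envelopes (nb ng nl : ℕ) where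
  pLo : Fin ng → ℝ × ℝ → ℝ
  pUp : Fin ng → ℝ × ℝ → ℝ
  cosLo : Fin nl → ℝ × ℝ × ℝ → ℝ
  cosUp : Fin nl → ℝ × ℝ × ℝ → ℝ
  sinLo : Fin nl → ℝ × ℝ × ℝ → ℝ
  sinUp : Fin nl → ℝ × ℝ × ℝ → ℝ
  vLo : Fin nb → ℝ → ℝ
  vUp : Fin nb → ℝ → ℝ

/-- All bounding functions are quadratic. -/
structure Envelopes.IsQuadratic {nb ng nl : ℕ} (e : Envelopes nb ng nl) : Prop where
  pLo : ∀ i, IsQuadraticFun (e.pLo i)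
  pUp : ∀ i, IsQuadraticFun (e.pUp i)
  cosLo : ∀ l, IsQuadraticFun (e.cosLo l)
  cosUp : ∀ l, IsQuadraticFun (e.cosUp l)
  sinLo : ∀ l, IsQuadraticFun (e.sinLo l)
  sinUp : ∀ l, IsQuadraticFun (e.sinUp l)
  vLo : ∀ k, IsQuadraticFun (e.vLo k)
  vUp : ∀ k, IsQuadraticFun (e.vUp k)

namespace PowerNetwork

variable {nb ng nd nl : ℕ}

/-! ### Bus types, index sets and variables -/

/-- PV (generator) buses. -/
abbrev PVBus (N : PowerNetwork nb ng nd nl) := {k : Fin nb // ∃ i, N.genBus i = k}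

/-- PQ (load) buses: all the others. -/
abbrev PQBus (N : PowerNetwork nb ng nd nl) := {k : Fin nb // ¬ ∃ i, N.genBus i = k}

/-- Non-reference buses. -/
abbrev NSBus (N : PowerNetwork nb ng nd nl) := {k : Fin nb // k ≠ N.ref}

/-- Indices of the internal state `x = (θ_ns, v_pq, Δ)`. -/
abbrev StateIdx (N : PowerNetwork nb ng nd nl) := N.NSBus ⊕ N.PQBus ⊕ Unit

/-- Indices of the transformed state `z = (φ, v_pq, Δ)`. -/
abbrev ZIdx (N : PowerNetwork nb ng nd nl) := Fin nl ⊕ N.PQBus ⊕ Unit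

/-- Indices of the dispatch vector `u = (p_ref, v_g)`. -/
abbrev DispIdx (N : PowerNetwork nb ng nd nl) := Fin ng ⊕ N.PVBus

/-- Indices of the power flow equations: active power at all buses, reactive power at PQ buses. -/
abbrev EqIdx (N : PowerNetwork nb ng nd nl) := Fin nb ⊕ N.PQBus

/-- The phase angle of bus `k`; it is zero at the reference bus. -/
def theta (N : PowerNetwork nb ng nd nl) (x : N.StateIdx → ℝ) (k : Fin nb) : ℝ :=
  if h : k = N.ref then 0 else x (.inl ⟨k, h⟩)

/-- The angle difference along line `l`. -/
def phi (N : PowerNetwork nb ng nd nl) (x : N.StateIdx → ℝ) (l : Fin nl) : ℝ :=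
  N.theta x (N.src l) - N.theta x (N.tgt l)

/-- The vector of all bus voltage magnitudes: `v_g` at PV buses, `v_pq` at PQ buses. -/
def volt (N : PowerNetwork nb ng nd nl) (vpq : N.PQBus → ℝ) (u : N.DispIdx → ℝ) (k : Fin nb) : ℝ :=
  if h : ∃ i, N.genBus i = k then u (.inr ⟨k, h⟩) else vpq ⟨k, h⟩

/-- The bus voltage magnitudes at state `x` and dispatch `u`. -/
def v (N : PowerNetwork nb ng nd nl) (x : N.StateIdx → ℝ) (u : N.DispIdx → ℝ) (k : Fin nb) : ℝ :=
  N.volt (fun j => x (.inr (.inl j))) u k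

/-- The imbalance `Δ` of a state. -/
def imb (N : PowerNetwork nb ng nd nl) (x : N.StateIdx → ℝ) : ℝ := x (.inr (.inr ()))

/-- Active power generation under the distributed slack policy. -/
def pg (N : PowerNetwork nb ng nd nl) (x : N.StateIdx → ℝ) (u : N.DispIdx → ℝ) (i : Fin ng) : ℝ :=
  u (.inl i) + N.α i * N.imb x

/-! ### Constant matrices -/

def Ef (N : PowerNetwork nb ng nd nl) : Matrix (Fin nb) (Fin nl) ℝ :=
  fun k l => if N.src l = k then 1 else 0

def Et (N : PowerNetwork nb ng nd nl) : Matrix (Fin nb) (Fin nl) ℝ :=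
  fun k l => if N.tgt l = k then 1 else 0

/-- The incidence matrix. -/
def E (N : PowerNetwork nb ng nd nl) : Matrix (Fin nb) (Fin nl) ℝ := N.Ef - N.Et

def Cg (N : PowerNetwork nb ng nd nl) : Matrix (Fin nb) (Fin ng) ℝ :=
  fun k i => if N.genBus i = k then 1 else 0

def Cd (N : PowerNetwork nb ng nd nl) : Matrix (Fin nb) (Fin nd) ℝ :=
  fun k i => if N.loadBus i = k then 1 else 0

/-- Conductances of the lines as diagonal matrices. -/
def reDiag (Y : Fin nl → ℂ) : Matrix (Fin nl) (Fin nl) ℝ := diagonal fun l => (Y l).re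

/-- Susceptances of the lines as diagonal matrices. -/
def imDiag (Y : Fin nl → ℂ) : Matrix (Fin nl) (Fin nl) ℝ := diagonal fun l => (Y l).im

/-! The transformed admittance matrices. -/

def Gc (N : PowerNetwork nb ng nd nl) : Matrix (Fin nb) (Fin nl) ℝ :=
  N.Ef * reDiag N.Yft + N.Et * reDiag N.Ytf

def Gs (N : PowerNetwork nb ng nd nl) : Matrix (Fin nb) (Fin nl) ℝ :=
  N.Ef * reDiag N.Yft - N.Et * reDiag N.Ytf

def Bc (N : PowerNetwork nb ng nd nl) : Matrix (Fin nb) (Fin nl) ℝ :=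
  N.Ef * imDiag N.Yft + N.Et * imDiag N.Ytf

def Bs (N : PowerNetwork nb ng nd nl) : Matrix (Fin nb) (Fin nl) ℝ :=
  N.Ef * imDiag N.Yft - N.Et * imDiag N.Ytf

/-- The diagonal entries `∑_{l from k} Yff + ∑_{l to k} Ytt + Ysh` of the bus admittance matrix. -/
def Yd (N : PowerNetwork nb ng nd nl) (k : Fin nb) : ℂ :=
  (∑ l, if N.src l = k then N.Yff l else 0) + (∑ l, if N.tgt l = k then N.Ytt l else 0) + N.Ysh k

def Gd (N : PowerNetwork nb ng nd nl) : Matrix (Fin nb) (Fin nb) ℝ := diagonal fun k => (N.Yd k).re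

def Bd (N : PowerNetwork nb ng nd nl) : Matrix (Fin nb) (Fin nb) ℝ := diagonal fun k => (N.Yd k).im

/-- `A = blkdiag (E_nsᵀ, I, 1)`, so that `z = A x`. -/
def A (N : PowerNetwork nb ng nd nl) : Matrix N.ZIdx N.StateIdx ℝ :=
  fromBlocks (N.E.submatrix (Subtype.val : N.NSBus → Fin nb) id)ᵀ 0 0 1

/-- The coefficient matrix of the basis functions in the power flow equations. -/
def M (N : PowerNetwork nb ng nd nl) : Matrix N.EqIdx (BasisIdx nb ng nl) ℝ :=
  fromRows
    (fromCols N.Cg (fromCols (-N.Gc) (fromCols (-N.Bs) (-N.Gd))))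
    (fromCols 0 (fromCols (N.Bc.submatrix Subtype.val id)
      (fromCols (-(N.Gs.submatrix Subtype.val id)) (N.Bd.submatrix Subtype.val id))))

/-- The coefficient matrix of `w` in the power flow equations. -/
def R (N : PowerNetwork nb ng nd nl) : Matrix N.EqIdx (UncIdx nd) ℝ :=
  -fromBlocks N.Cd 0 0 (N.Cd.submatrix Subtype.val id)

/-- The reactive power injections at PV buses are `Lq ψ`. -/
def Lq (N : PowerNetwork nb ng nd nl) : Matrix N.PVBus (BasisIdx nb ng nl) ℝ :=
  fromCols 0 (fromCols (-(N.Bc.submatrix Subtype.val id))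
    (fromCols (N.Gs.submatrix Subtype.val id) (-(N.Bd.submatrix Subtype.val id))))

/-- The line flows are `Lline c ψ`. -/
def Lline (N : PowerNetwork nb ng nd nl) : FlowKind → Matrix (Fin nl) (BasisIdx nb ng nl) ℝ
  | .pf => fromCols 0 (fromCols (reDiag N.Yft) (fromCols (imDiag N.Yft)
      (reDiag N.Yff * N.Efᵀ)))
  | .qf => fromCols 0 (fromCols (-imDiag N.Yft) (fromCols (reDiag N.Yft)
      (-(imDiag N.Yff * N.Efᵀ))))
  | .pt => fromCols 0 (fromCols (reDiag N.Ytf) (fromCols (-imDiag N.Ytf)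
      (reDiag N.Ytt * N.Etᵀ)))
  | .qt => fromCols 0 (fromCols (-imDiag N.Ytf) (fromCols (-reDiag N.Ytf)
      (-(imDiag N.Ytt * N.Etᵀ))))

/-! ### Basis functions, Jacobians and the residual -/

/-- The basis functions `ψ (x, u)`. -/
def psi (N : PowerNetwork nb ng nd nl) (x : N.StateIdx → ℝ) (u : N.DispIdx → ℝ) :
    BasisIdx nb ng nl → ℝ
  | .inl i => N.pg x u i
  | .inr (.inl l) => N.v x u (N.src l) * N.v x u (N.tgt l) * Real.cos (N.phi x l)
  | .inr (.inr (.inl l)) => N.v x u (N.src l) * N.v x u (N.tgt l) * Real.sin (N.phi x l)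
  | .inr (.inr (.inr k)) => N.v x u k ^ 2

/-- `f (x, u, w) = M ψ(x, u) + R w`. -/
def f (N : PowerNetwork nb ng nd nl) (x : N.StateIdx → ℝ) (u : N.DispIdx → ℝ)
    (w : UncIdx nd → ℝ) : N.EqIdx → ℝ :=
  N.M *ᵥ N.psi x u + N.R *ᵥ w

/-- The Jacobian of `ψ` in `x` at `(x0, u0)`. -/
def Jpsi (N : PowerNetwork nb ng nd nl) (x0 : N.StateIdx → ℝ) (u0 : N.DispIdx → ℝ) :
    Matrix (BasisIdx nb ng nl) N.StateIdx ℝ :=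
  LinearMap.toMatrix' (fderiv ℝ (fun x => N.psi x u0) x0).toLinearMap

/-- The power flow Jacobian, i.e. that of `f` in `x`, at `(x0, u0, w0)`. -/
def Jf (N : PowerNetwork nb ng nd nl) (x0 : N.StateIdx → ℝ) (u0 : N.DispIdx → ℝ)
    (w0 : UncIdx nd → ℝ) : Matrix N.EqIdx N.StateIdx ℝ :=
  LinearMap.toMatrix' (fderiv ℝ (fun x => N.f x u0 w0) x0).toLinearMap

/-- The residual `g (x, u) = ψ (x, u) - Jψ x`. -/
def resid (N : PowerNetwork nb ng nd nl) (x0 : N.StateIdx → ℝ) (u0 : N.DispIdx → ℝ)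
    (x : N.StateIdx → ℝ) (u : N.DispIdx → ℝ) : BasisIdx nb ng nl → ℝ :=
  N.psi x u - N.Jpsi x0 u0 *ᵥ x

/-! ### Robust feasibility -/

/-- The AC power flow equations at all buses. -/
def PowerFlow (N : PowerNetwork nb ng nd nl) (x : N.StateIdx → ℝ) (u : N.DispIdx → ℝ)
    (qg : Fin ng → ℝ) (w : UncIdx nd → ℝ) : Prop :=
  (∀ k, (N.Cg *ᵥ N.pg x u) k - (N.Cd *ᵥ fun i => w (.inl i)) k =
      ∑ l, N.v x u (N.src l) * N.v x u (N.tgt l) *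
        (N.Gc k l * Real.cos (N.phi x l) + N.Bs k l * Real.sin (N.phi x l)) +
      N.Gd k k * N.v x u k ^ 2) ∧
  (∀ k, (N.Cg *ᵥ qg) k - (N.Cd *ᵥ fun i => w (.inr i)) k =
      ∑ l, N.v x u (N.src l) * N.v x u (N.tgt l) *
        (N.Gs k l * Real.sin (N.phi x l) - N.Bc k l * Real.cos (N.phi x l)) -
      N.Bd k k * N.v x u k ^ 2)

/-- The flow of kind `c` on line `l`. -/
def flow (N : PowerNetwork nb ng nd nl) (x : N.StateIdx → ℝ) (u : N.DispIdx → ℝ) (c : FlowKind)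
    (l : Fin nl) : ℝ :=
  (N.Lline c *ᵥ N.psi x u) l

/-- The operational constraints. -/
structure Operational (N : PowerNetwork nb ng nd nl) (x : N.StateIdx → ℝ) (u : N.DispIdx → ℝ)
    (qg : Fin ng → ℝ) : Prop where
  p : ∀ i, N.pMin i ≤ N.pg x u i ∧ N.pg x u i ≤ N.pMax i
  q : ∀ i, N.qMin i ≤ qg i ∧ qg i ≤ N.qMax i
  volt : ∀ k, N.vMin k ≤ N.v x u k ∧ N.v x u k ≤ N.vMax k
  angle : ∀ l, N.phiMin l ≤ N.phi x l ∧ N.phi x l ≤ N.phiMax l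
  line_f : ∀ l, N.flow x u .pf l ^ 2 + N.flow x u .qf l ^ 2 ≤ N.sMax l ^ 2
  line_t : ∀ l, N.flow x u .pt l ^ 2 + N.flow x u .qt l ^ 2 ≤ N.sMax l ^ 2

/-- `u` is robustly feasible with respect to `W(γ)`. -/
def RobustlyFeasible (N : PowerNetwork nb ng nd nl) (w0 : UncIdx nd → ℝ)
    (Sig : Matrix (UncIdx nd) (UncIdx nd) ℝ) (u : N.DispIdx → ℝ) (γ : ℝ) : Prop :=
  ∀ w ∈ ellipsoid w0 Sig γ, ∃ (x : N.StateIdx → ℝ) (qg : Fin ng → ℝ),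
    N.PowerFlow x u qg w ∧ N.Operational x u qg

/-! ### Envelopes -/

/-- `e` consists of upper convex and lower concave envelopes of `h` (which is `ψ` or the residual):
the upper functions are convex, the lower ones concave, and they bound `h` whenever the quantities
on which the respective component depends are within their operational limits. -/
structure IsEnvelope (N : PowerNetwork nb ng nd nl)
    (h : (N.StateIdx → ℝ) → (N.DispIdx → ℝ) → BasisIdx nb ng nl → ℝ)
    (e : Envelopes nb ng nl) : Prop where
  pLo_concave : ∀ i, ConcaveOn ℝ Set.univ (e.pLo i)
  pUp_convex : ∀ i, ConvexOn ℝ Set.univ (e.pUp i)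
  cosLo_concave : ∀ l, ConcaveOn ℝ Set.univ (e.cosLo l)
  cosUp_convex : ∀ l, ConvexOn ℝ Set.univ (e.cosUp l)
  sinLo_concave : ∀ l, ConcaveOn ℝ Set.univ (e.sinLo l)
  sinUp_convex : ∀ l, ConvexOn ℝ Set.univ (e.sinUp l)
  vLo_concave : ∀ k, ConcaveOn ℝ Set.univ (e.vLo k)
  vUp_convex : ∀ k, ConvexOn ℝ Set.univ (e.vUp k)
  p_bound : ∀ x u i, N.pg x u i ∈ Set.Icc (N.pMin i) (N.pMax i) →
    e.pLo i (u (.inl i), N.imb x) ≤ h x u (.inl i) ∧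
    h x u (.inl i) ≤ e.pUp i (u (.inl i), N.imb x)
  cos_bound : ∀ x u l, N.v x u (N.src l) ∈ Set.Icc (N.vMin (N.src l)) (N.vMax (N.src l)) →
    N.v x u (N.tgt l) ∈ Set.Icc (N.vMin (N.tgt l)) (N.vMax (N.tgt l)) →
    N.phi x l ∈ Set.Icc (N.phiMin l) (N.phiMax l) →
    e.cosLo l (N.v x u (N.src l), N.v x u (N.tgt l), N.phi x l) ≤ h x u (.inr (.inl l)) ∧
    h x u (.inr (.inl l)) ≤ e.cosUp l (N.v x u (N.src l), N.v x u (N.tgt l), N.phi x l)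
  sin_bound : ∀ x u l, N.v x u (N.src l) ∈ Set.Icc (N.vMin (N.src l)) (N.vMax (N.src l)) →
    N.v x u (N.tgt l) ∈ Set.Icc (N.vMin (N.tgt l)) (N.vMax (N.tgt l)) →
    N.phi x l ∈ Set.Icc (N.phiMin l) (N.phiMax l) →
    e.sinLo l (N.v x u (N.src l), N.v x u (N.tgt l), N.phi x l) ≤ h x u (.inr (.inr (.inl l))) ∧
    h x u (.inr (.inr (.inl l))) ≤ e.sinUp l (N.v x u (N.src l), N.v x u (N.tgt l), N.phi x l)
  v_bound : ∀ x u k, N.v x u k ∈ Set.Icc (N.vMin k) (N.vMax k) →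
    e.vLo k (N.v x u k) ≤ h x u (.inr (.inr (.inr k))) ∧
    h x u (.inr (.inr (.inr k))) ≤ e.vUp k (N.v x u k)

/-- The envelopes `e` are bounded by `lo` and `up` at all vertices of the box of bus voltages, angle
differences and imbalances given by `u`, `zl`, `zu` (the voltages at PV buses are those of `u`). -/
structure VertexBounds (N : PowerNetwork nb ng nd nl) (e : Envelopes nb ng nl)
    (u : N.DispIdx → ℝ) (zl zu : N.ZIdx → ℝ) (lo up : BasisIdx nb ng nl → ℝ) : Prop where
  p : ∀ i, ∀ z ∈ ({zl, zu} : Set (N.ZIdx → ℝ)),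
    lo (.inl i) ≤ e.pLo i (u (.inl i), z (.inr (.inr ()))) ∧
    e.pUp i (u (.inl i), z (.inr (.inr ()))) ≤ up (.inl i)
  cos : ∀ l, ∀ a ∈ ({zl, zu} : Set (N.ZIdx → ℝ)), ∀ b ∈ ({zl, zu} : Set (N.ZIdx → ℝ)),
    ∀ c ∈ ({zl, zu} : Set (N.ZIdx → ℝ)),
    lo (.inr (.inl l)) ≤ e.cosLo l (N.volt (fun j => a (.inr (.inl j))) u (N.src l),
      N.volt (fun j => b (.inr (.inl j))) u (N.tgt l), c (.inl l)) ∧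
    e.cosUp l (N.volt (fun j => a (.inr (.inl j))) u (N.src l),
      N.volt (fun j => b (.inr (.inl j))) u (N.tgt l), c (.inl l)) ≤ up (.inr (.inl l))
  sin : ∀ l, ∀ a ∈ ({zl, zu} : Set (N.ZIdx → ℝ)), ∀ b ∈ ({zl, zu} : Set (N.ZIdx → ℝ)),
    ∀ c ∈ ({zl, zu} : Set (N.ZIdx → ℝ)),
    lo (.inr (.inr (.inl l))) ≤ e.sinLo l (N.volt (fun j => a (.inr (.inl j))) u (N.src l),
      N.volt (fun j => b (.inr (.inl j))) u (N.tgt l), c (.inl l)) ∧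
    e.sinUp l (N.volt (fun j => a (.inr (.inl j))) u (N.src l),
      N.volt (fun j => b (.inr (.inl j))) u (N.tgt l), c (.inl l)) ≤ up (.inr (.inr (.inl l)))
  v : ∀ k, ∀ z ∈ ({zl, zu} : Set (N.ZIdx → ℝ)),
    lo (.inr (.inr (.inr k))) ≤ e.vLo k (N.volt (fun j => z (.inr (.inl j))) u k) ∧
    e.vUp k (N.volt (fun j => z (.inr (.inl j))) u k) ≤ up (.inr (.inr (.inr k)))

/-! ### The robust feasibility condition -/

/-- The scalar decision variables: the dispatch `u`, the state bounds `z^ℓ, z^u`, the residual bounds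
`g_P^ℓ, g_P^u`, the basis function bounds `ψ_P^ℓ, ψ_P^u`, the reactive power bounds `q_g^ℓ, q_g^u`,
the line flow bounds and the radius `γ`. -/
inductive Var (N : PowerNetwork nb ng nd nl) where
  | u (j : N.DispIdx)
  | zl (j : N.ZIdx)
  | zu (j : N.ZIdx)
  | gl (j : BasisIdx nb ng nl)
  | gu (j : BasisIdx nb ng nl)
  | psil (j : BasisIdx nb ng nl)
  | psiu (j : BasisIdx nb ng nl)
  | ql (i : Fin ng)
  | qu (i : Fin ng)
  | s (c : FlowKind) (l : Fin nl)
  | gamma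

/-- `K = -A J⁻¹ M`. -/
def K (N : PowerNetwork nb ng nd nl) (Jinv : Matrix N.StateIdx N.EqIdx ℝ) :
    Matrix N.ZIdx (BasisIdx nb ng nl) ℝ :=
  -(N.A * Jinv * N.M)

/-- The margin `ξ^u(γ)`; `ξ^ℓ(γ)` is `ξ^u(-γ)`. -/
def xi (N : PowerNetwork nb ng nd nl) (Jinv : Matrix N.StateIdx N.EqIdx ℝ) (w0 : UncIdx nd → ℝ)
    (S : Matrix (UncIdx nd) (UncIdx nd) ℝ) (γ : ℝ) (j : N.ZIdx) : ℝ :=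
  -((N.A * Jinv * N.R) *ᵥ w0) j + γ * rowNorm (N.A * Jinv * N.R * S) j

/-- The margin `ζ^u(γ)`, with the rows of `S = Σ^{1/2}` of the reactive powers; `ζ^ℓ(γ)` is
`ζ^u(-γ)`. -/
def zeta (N : PowerNetwork nb ng nd nl) (w0 : UncIdx nd → ℝ)
    (S : Matrix (UncIdx nd) (UncIdx nd) ℝ) (γ : ℝ) (k : N.PVBus) : ℝ :=
  (N.Cd.submatrix (Subtype.val : N.PVBus → Fin nb) id *ᵥ fun i => w0 (.inr i)) k +
    γ * rowNorm (N.Cd.submatrix (Subtype.val : N.PVBus → Fin nb) id *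
      S.submatrix (Sum.inr : Fin nd → UncIdx nd) id) k

/-- The robust feasibility condition on the decision variables `y`, built with the inverse power
flow Jacobian `Jinv`, the nominal `w0`, the factor `S = Σ^{1/2}`, envelopes `eg` of the residual and
`eψ` of the basis functions. -/
structure RobustCondition (N : PowerNetwork nb ng nd nl) (Jinv : Matrix N.StateIdx N.EqIdx ℝ)
    (w0 : UncIdx nd → ℝ) (S : Matrix (UncIdx nd) (UncIdx nd) ℝ) (eg eψ : Envelopes nb ng nl)
    (y : N.Var → ℝ) : Prop where
  ordered : ∀ j, y (.zl j) ≤ y (.zu j)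
  resid_bounds : N.VertexBounds eg (fun j => y (.u j)) (fun j => y (.zl j)) (fun j => y (.zu j))
    (fun j => y (.gl j)) (fun j => y (.gu j))
  basis_bounds : N.VertexBounds eψ (fun j => y (.u j)) (fun j => y (.zl j)) (fun j => y (.zu j))
    (fun j => y (.psil j)) (fun j => y (.psiu j))
  self_map_upper : ∀ j, (posEntries (N.K Jinv) *ᵥ fun b => y (.gu b)) j +
    (negEntries (N.K Jinv) *ᵥ fun b => y (.gl b)) j + N.xi Jinv w0 S (y .gamma) j ≤ y (.zu j)
  self_map_lower : ∀ j, y (.zl j) ≤ (posEntries (N.K Jinv) *ᵥ fun b => y (.gl b)) j +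
    (negEntries (N.K Jinv) *ᵥ fun b => y (.gu b)) j + N.xi Jinv w0 S (-y .gamma) j
  p_lower : ∀ i, N.pMin i ≤ y (.u (.inl i)) + N.α i * y (.zl (.inr (.inr ())))
  p_upper : ∀ i, y (.u (.inl i)) + N.α i * y (.zu (.inr (.inr ()))) ≤ N.pMax i
  q_lower : ∀ i, N.qMin i ≤ y (.ql i)
  q_upper : ∀ i, y (.qu i) ≤ N.qMax i
  vpq_lower : ∀ k : N.PQBus, N.vMin k ≤ y (.zl (.inr (.inl k)))
  vpq_upper : ∀ k : N.PQBus, y (.zu (.inr (.inl k))) ≤ N.vMax k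
  vg_lower : ∀ k : N.PVBus, N.vMin k ≤ y (.u (.inr k))
  vg_upper : ∀ k : N.PVBus, y (.u (.inr k)) ≤ N.vMax k
  phi_lower : ∀ l, N.phiMin l ≤ y (.zl (.inl l))
  phi_upper : ∀ l, y (.zu (.inl l)) ≤ N.phiMax l
  line_f : ∀ l, y (.s .pf l) ^ 2 + y (.s .qf l) ^ 2 ≤ N.sMax l ^ 2
  line_t : ∀ l, y (.s .pt l) ^ 2 + y (.s .qt l) ^ 2 ≤ N.sMax l ^ 2
  reactive_upper : ∀ k : N.PVBus, (posEntries N.Lq *ᵥ fun b => y (.psiu b)) k +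
    (negEntries N.Lq *ᵥ fun b => y (.psil b)) k + N.zeta w0 S (y .gamma) k ≤
    (N.Cg *ᵥ fun i => y (.qu i)) k
  reactive_lower : ∀ k : N.PVBus, (N.Cg *ᵥ fun i => y (.ql i)) k ≤
    (negEntries N.Lq *ᵥ fun b => y (.psiu b)) k + (posEntries N.Lq *ᵥ fun b => y (.psil b)) k +
    N.zeta w0 S (-y .gamma) k
  flow_upper : ∀ c l, (posEntries (N.Lline c) *ᵥ fun b => y (.psiu b)) l +
    (negEntries (N.Lline c) *ᵥ fun b => y (.psil b)) l ≤ y (.s c l)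
  flow_lower : ∀ c l, -(negEntries (N.Lline c) *ᵥ fun b => y (.psiu b)) l -
    (posEntries (N.Lline c) *ᵥ fun b => y (.psil b)) l ≤ y (.s c l)

end PowerNetwork

end

/-! (a) Write `ψ(x,u) = Jψ x + g(x,u)`. Since `J_f = M Jψ`, the equations `M ψ + R w = 0` become `x
= -J_f⁻¹ (M g(x,u) + R w)`. For fixed `w`, a residual vector `g` in the box `[g^ℓ, g^u]` thus
defines a state `T g`, and `A (T g) = K g - A J_f⁻¹ R w`. Sign-split interval bounds on `K g` and
Cauchy-Schwarz on the ellipsoid put `A (T g)` into `[z^ℓ, z^u]`. The envelopes are valid there, and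
their convexity carries the vertex bounds to the whole box, so the residual at `T g` lies in `[g^ℓ,
g^u]` again. Brouwer's theorem gives a fixed point, which is a power flow solution
(`exists_f_eq_zero`). The fixed point is sought among residuals because a vector in `[z^ℓ, z^u]`
need not have the form `A x`: angle differences are dependent around cycles.

The equations `f = 0` omit reactive power at PV buses. There the balance fixes only the total
generation of each bus, which the `ψ` box and the margins `ζ` place between the summed limits;
`exists_reactive_dispatch` splits it over the generators. The `ψ` box also bounds the line flows.

(b) Each constraint is affine, a sum of two squares of variables bounded by a constant, or a convex
envelope of some variables bounded by a variable. The matrices and row norms are constants, so `γ`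
enters affinely.

Brouwer's theorem is proved by volumes. If `r = id + g` were a `C¹` retraction of the ball onto its
sphere, `id + t g` would permute the open ball for small `t > 0`, so `∫ det (1 + t Dg)` would be its
volume. This integral is a polynomial in `t`, hence also the volume at `t = 1`, where the integrand
`det Dr` vanishes. -/

/-! ### The Brouwer fixed point theorem -/

/-- Finitely many arbitrarily small positive nodes determine the value at `1` of all polynomials of
bounded degree. -/
theorem exists_extrapolation_weights (n : ℕ) {δ : ℝ} (hδ : 0 < δ) :
    ∃ (s : Finset ℝ) (c : ℝ → ℝ), (∀ t ∈ s, 0 < t ∧ t < δ) ∧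
      ∀ p : Polynomial ℝ, p.natDegree ≤ n → p.eval 1 = ∑ t ∈ s, c t * p.eval t := by
  -- Lagrange interpolation at `n + 1` nodes; the weights are the Lagrange basis polynomials
  -- evaluated at `1`.
  obtain ⟨s, hs, hcard⟩ := (Set.Ioo_infinite hδ).exists_subset_card_eq (n + 1)
  refine ⟨s, fun t => (Lagrange.basis s id t).eval 1, fun t ht => hs ht, fun p hp => ?_⟩
  have hdeg : p.degree < s.card := by
    rw [hcard]
    exact lt_of_le_of_lt Polynomial.degree_le_natDegree (by exact_mod_cast Nat.lt_succ_of_le hp)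
  have h := Lagrange.eq_interpolate (s := s) (v := id) Function.injective_id.injOn hdeg
  conv_lhs => rw [h]
  rw [Lagrange.interpolate_apply, Polynomial.eval_finsetSum]
  refine Finset.sum_congr rfl fun t _ => ?_
  simp [mul_comm]

/-- `det (1 + t • A)` is a polynomial in `t` of degree at most the dimension. -/
theorem exists_polynomial_eval_eq_det_one_add_smul {E : Type*} [NormedAddCommGroup E]
    [NormedSpace ℝ E] [FiniteDimensional ℝ E] (A : E →L[ℝ] E) :
    ∃ p : Polynomial ℝ, p.natDegree ≤ Module.finrank ℝ E ∧
      ∀ t : ℝ, p.eval t = (1 + t • A : E →L[ℝ] E).det := by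
  let b := Module.finBasis ℝ E
  let B := LinearMap.toMatrix b b A.toLinearMap
  refine ⟨(Matrix.det ((Polynomial.X : Polynomial ℝ) • B.map Polynomial.C +
    (1 : Matrix _ _ ℝ).map Polynomial.C)), ?_, fun t => ?_⟩
  · simpa using Polynomial.natDegree_det_X_add_C_le B 1
  · rw [ContinuousLinearMap.det, ← LinearMap.det_toMatrix b, ← Polynomial.coe_evalRingHom,
      RingHom.map_det]
    congr 1
    have : ((1 + t • A : E →L[ℝ] E) : E →ₗ[ℝ] E) = 1 + t • (A : E →ₗ[ℝ] E) := rfl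
    rw [this, map_add (LinearMap.toMatrix b b), map_smul (LinearMap.toMatrix b b),
      LinearMap.toMatrix_one]
    ext i j
    simp only [Matrix.one_apply, B, map_add, Matrix.add_apply, RingHom.mapMatrix_apply,
      Matrix.map_apply, Matrix.smul_apply, smul_eq_mul, Polynomial.eval_mul,
      Polynomial.coe_evalRingHom, Polynomial.eval_X, Polynomial.eval_C]
    ring

/-- A perturbation of the identity by a contraction supported in `U` is a bijection of `U`. -/
theorem bijOn_add_of_lipschitzWith {E : Type*} [NormedAddCommGroup E] [CompleteSpace E]
    {h : E → E} {c : NNReal} (hc : c < 1) (hh : LipschitzWith c h) {U : Set E}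
    (hU : ∀ x ∉ U, h x = 0) : Set.BijOn (fun x => x + h x) U U := by
  have hinj : Function.Injective fun x => x + h x := by
    intro x y hxy
    have hxy' : x + h x = y + h y := hxy
    have h1 : x - y = h y - h x := by
      rw [sub_eq_sub_iff_add_eq_add, hxy', add_comm]
    have h2 := hh.dist_le_mul y x
    rw [dist_eq_norm, ← h1, dist_comm, dist_eq_norm] at h2
    have hc' : (c : ℝ) < 1 := by exact_mod_cast hc
    have : ‖x - y‖ = 0 := by nlinarith [norm_nonneg (x - y)]
    exact sub_eq_zero.1 (norm_eq_zero.1 this)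
  have hsurj : ∀ y, ∃ x, x + h x = y := by
    intro y
    -- Solving `x + h x = y` means finding a fixed point of the contraction `x ↦ y - h x`.
    have hK : ContractingWith c fun x => y - h x :=
      ⟨hc, by simpa using (LipschitzWith.const y).sub hh⟩
    refine ⟨hK.fixedPoint, ?_⟩
    have := hK.fixedPoint_isFixedPt
    rw [Function.IsFixedPt] at this
    nth_rewrite 1 [← this]
    abel
  refine ⟨fun x hx => ?_, hinj.injOn, fun y hy => ?_⟩
  -- Off `U` the map is the identity, so by injectivity no point of `U` can be sent there.
  · by_contra hn
    have : x + h x = x := hinj (by simp [hU _ hn])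
    exact hn (by simpa [this] using hx)
  · obtain ⟨x, rfl⟩ := hsurj y
    refine ⟨x, ?_, rfl⟩
    by_contra hn
    simp [hU x hn, hn] at hy

/-- A function that is Lipschitz on the closed unit ball and vanishes on the sphere remains
Lipschitz when extended by zero. -/
theorem lipschitzWith_indicator_ball {E F : Type*} [NormedAddCommGroup E] [NormedSpace ℝ E]
    [NormedAddCommGroup F] {g : E → F} {L : NNReal}
    (hg : LipschitzOnWith L g (Metric.closedBall 0 1)) (h0 : ∀ x, ‖x‖ = 1 → g x = 0) :
    LipschitzWith L ((Metric.ball (0 : E) 1).indicator g) := by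
  have key : ∀ x y : E, x ∈ Metric.ball (0 : E) 1 → y ∉ Metric.ball (0 : E) 1 →
      dist (g x) 0 ≤ L * dist x y := by
    intro x y hx hy
    have hcont : Continuous fun t : ℝ => ‖AffineMap.lineMap x y t‖ :=
      AffineMap.lineMap_continuous.norm
    -- The segment from inside to outside meets the sphere, where `g` vanishes, no farther from `x`
    -- than `y` is.
    obtain ⟨t, ht, hs⟩ : ∃ t ∈ Set.Icc (0 : ℝ) 1, ‖AffineMap.lineMap x y t‖ = 1 := by
      have := intermediate_value_Icc (zero_le_one' ℝ) hcont.continuousOn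
      apply this
      simp at hx hy ⊢
      exact ⟨hx.le, hy⟩
    have h1 := hg.dist_le_mul x (Metric.ball_subset_closedBall hx) (AffineMap.lineMap x y t)
      (by simp [hs])
    rw [h0 _ hs] at h1
    refine h1.trans (mul_le_mul_of_nonneg_left ?_ L.2)
    rw [dist_left_lineMap, Real.norm_eq_abs, abs_of_nonneg ht.1]
    exact mul_le_of_le_one_left dist_nonneg ht.2
  refine LipschitzWith.of_dist_le_mul fun x y => ?_
  by_cases hx : x ∈ Metric.ball (0 : E) 1 <;> by_cases hy : y ∈ Metric.ball (0 : E) 1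
  · rw [Set.indicator_of_mem hx, Set.indicator_of_mem hy]
    exact hg.dist_le_mul x (Metric.ball_subset_closedBall hx) y (Metric.ball_subset_closedBall hy)
  · rw [Set.indicator_of_mem hx, Set.indicator_of_notMem hy]
    exact key x y hx hy
  · rw [Set.indicator_of_notMem hx, Set.indicator_of_mem hy, dist_comm, dist_comm x y]
    exact key y x hy hx
  · rw [Set.indicator_of_notMem hx, Set.indicator_of_notMem hy, dist_self]
    positivity

open MeasureTheory in
/-- There is no `C¹` retraction of the closed unit ball onto the sphere. -/
theorem not_exists_contDiffAt_retraction {E : Type*} [NormedAddCommGroup E]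
    [InnerProductSpace ℝ E] [FiniteDimensional ℝ E] {r : E → E}
    (hr : ∀ x ∈ Metric.closedBall (0 : E) 1, ContDiffAt ℝ 1 r x)
    (hsphere : ∀ x ∈ Metric.closedBall (0 : E) 1, ‖r x‖ = 1)
    (hid : ∀ x, ‖x‖ = 1 → r x = x) : False := by
  borelize E
  let μ : Measure E := Measure.addHaar
  have hcpt : IsCompact (Metric.closedBall (0 : E) 1) := isCompact_closedBall 0 1
  -- `g` vanishes on the sphere, so its extension by zero is Lipschitz and the maps `id + t • g` fix
  -- the boundary.
  let g : E → E := fun x => r x - x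
  have hg : ∀ x ∈ Metric.closedBall (0 : E) 1, ContDiffAt ℝ 1 g x := fun x hx =>
    (hr x hx).sub contDiffAt_id
  have hg' : ContinuousOn (fderiv ℝ g) (Metric.closedBall (0 : E) 1) := fun x hx =>
    ((hg x hx).continuousAt_fderiv one_ne_zero).continuousWithinAt
  obtain ⟨L, hL⟩ : ∃ L : NNReal, ∀ x ∈ Metric.closedBall (0 : E) 1, ‖fderiv ℝ g x‖₊ ≤ L := by
    obtain ⟨C, hC⟩ := hcpt.exists_bound_of_continuousOn hg'
    exact ⟨C.toNNReal, fun x hx => by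
      rw [← NNReal.coe_le_coe]; exact (hC x hx).trans (Real.le_coe_toNNReal C)⟩
  have hlip : LipschitzOnWith L g (Metric.closedBall 0 1) :=
    (convex_closedBall (0 : E) 1).lipschitzOnWith_of_nnnorm_fderiv_le
      (fun x hx => (hg x hx).differentiableAt one_ne_zero) hL
  have hlip' := lipschitzWith_indicator_ball hlip fun x hx => by simp [g, hid x hx]
  -- Positivity of the determinant near the identity removes the absolute value in the change of
  -- variables.
  obtain ⟨ε, hε, hdet⟩ : ∃ ε > 0, ∀ A : E →L[ℝ] E, ‖A‖ < ε → 0 < (1 + A).det := by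
    have hcont : Continuous fun A : E →L[ℝ] E => (1 + A).det :=
      ContinuousLinearMap.continuous_det.comp (by fun_prop)
    have h0 : ∀ᶠ A : E →L[ℝ] E in nhds 0, 0 < (1 + A).det :=
      hcont.continuousAt.eventually (lt_mem_nhds (by simp [ContinuousLinearMap.det]))
    obtain ⟨ε, hε, h⟩ := Metric.eventually_nhds_iff.1 h0
    exact ⟨ε, hε, fun A hA => h (by simpa using hA)⟩
  -- For `t < δ` the map `t • g` is a contraction (bound `1`) and `det (1 + t • Dg)` is positive
  -- (bound `ε`).
  obtain ⟨δ, hδ, hδL⟩ : ∃ δ : ℝ, 0 < δ ∧ δ * L < min 1 ε := by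
    have hm : 0 < min 1 ε := lt_min one_pos hε
    refine ⟨min 1 ε / (L + 1), by positivity, ?_⟩
    rw [div_mul_eq_mul_div, div_lt_iff₀ (by positivity)]
    nlinarith [L.2]
  have hvol : ∀ t : ℝ, 0 < t → t < δ →
      ∫ x in Metric.ball (0 : E) 1, (1 + t • fderiv ℝ g x : E →L[ℝ] E).det ∂μ =
        μ.real (Metric.ball (0 : E) 1) := by
    intro t ht0 htδ
    have htL : t * L < min 1 ε := lt_of_le_of_lt (by gcongr) hδL
    have hbij : Set.BijOn (fun x => x + t • g x) (Metric.ball (0 : E) 1) (Metric.ball 0 1) := by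
      have hl : LipschitzWith (‖t‖₊ * L)
          fun x => t • (Metric.ball (0 : E) 1).indicator g x :=
        (lipschitzWith_smul t).comp hlip'
      have hc : ‖t‖₊ * L < 1 := by
        rw [← NNReal.coe_lt_coe, NNReal.coe_mul, coe_nnnorm, Real.norm_of_nonneg ht0.le]
        exact htL.trans_le (min_le_left _ _)
      refine (bijOn_add_of_lipschitzWith hc hl fun x hx => ?_).congr fun x hx => ?_
      · simp only [Set.indicator_of_notMem hx, smul_zero]
      · simp only [Set.indicator_of_mem hx]
    have hder : ∀ x ∈ Metric.ball (0 : E) 1, HasFDerivWithinAt (fun x => x + t • g x)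
        (1 + t • fderiv ℝ g x : E →L[ℝ] E) (Metric.ball 0 1) x := fun x hx =>
      ((hasFDerivAt_id x).add (((hg x (Metric.ball_subset_closedBall hx)).differentiableAt
        one_ne_zero).hasFDerivAt.const_smul t)).hasFDerivWithinAt
    have hcv := integral_image_eq_integral_abs_det_fderiv_smul μ measurableSet_ball hder
      hbij.injOn (fun _ => (1 : ℝ))
    rw [hbij.image_eq] at hcv
    simp only [smul_eq_mul, mul_one, integral_const, MeasurableSet.univ, measureReal_restrict_apply,
      Set.univ_inter] at hcv
    rw [hcv]
    refine setIntegral_congr_fun measurableSet_ball fun x hx => ?_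
    refine (abs_of_pos (hdet _ ?_)).symm
    rw [norm_smul, Real.norm_of_nonneg ht0.le]
    refine lt_of_le_of_lt ?_ (htL.trans_le (min_le_right _ _))
    gcongr
    exact hL x (Metric.ball_subset_closedBall hx)
  have hint : ∀ t : ℝ, IntegrableOn (fun x => (1 + t • fderiv ℝ g x : E →L[ℝ] E).det)
      (Metric.ball (0 : E) 1) μ := fun t =>
    (ContinuousOn.integrableOn_compact hcpt (ContinuousLinearMap.continuous_det.comp_continuousOn
      (continuousOn_const.add (hg'.const_smul t)))).mono_set Metric.ball_subset_closedBall
  -- All nodes lie below `δ`, where the volume identity is known. Extrapolating the determinant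
  -- pointwise carries it to `t = 1`, and the weights sum to one, as the constant polynomial shows.
  obtain ⟨s, c, hs, hsum⟩ := exists_extrapolation_weights (Module.finrank ℝ E) hδ
  have hone : 1 = ∑ t ∈ s, c t := by simpa using hsum 1 (by simp)
  have hpos : 0 < μ.real (Metric.ball (0 : E) 1) :=
    ENNReal.toReal_pos (Metric.measure_ball_pos μ 0 one_pos).ne' measure_ball_lt_top.ne
  have htotal : ∫ x in Metric.ball (0 : E) 1, (1 + (1 : ℝ) • fderiv ℝ g x : E →L[ℝ] E).det ∂μ =
      μ.real (Metric.ball (0 : E) 1) := by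
    have hpt : ∀ x, (1 + (1 : ℝ) • fderiv ℝ g x : E →L[ℝ] E).det =
        ∑ t ∈ s, c t * (1 + t • fderiv ℝ g x : E →L[ℝ] E).det := by
      intro x
      obtain ⟨p, hp, hpe⟩ := exists_polynomial_eval_eq_det_one_add_smul (fderiv ℝ g x)
      simp only [← hpe]
      exact hsum p hp
    simp only [hpt]
    rw [integral_finsetSum _ fun t _ => (hint t).const_mul (c t)]
    simp only [integral_const_mul]
    rw [Finset.sum_congr rfl fun t ht => by rw [hvol t (hs t ht).1 (hs t ht).2], ← Finset.sum_mul,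
      ← hone, one_mul]
  have hzero : ∀ x ∈ Metric.ball (0 : E) 1,
      (1 + (1 : ℝ) • fderiv ℝ g x : E →L[ℝ] E).det = 0 := by
    intro x hx
    have hx' := Metric.ball_subset_closedBall hx
    have hrd := (hr x hx').differentiableAt one_ne_zero
    have hgr : (1 + (1 : ℝ) • fderiv ℝ g x : E →L[ℝ] E) = fderiv ℝ r x := by
      have hgx : fderiv ℝ g x = fderiv ℝ r x - 1 := (hrd.hasFDerivAt.sub (hasFDerivAt_id x)).fderiv
      rw [one_smul, hgx, add_sub_cancel]
    -- Differentiating `‖r‖² = 1` makes the range of `Dr` orthogonal to the unit vector `r x`, so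
    -- `Dr` is not surjective.
    have horth : ∀ v, inner ℝ (r x) (fderiv ℝ r x v) = 0 := by
      intro v
      have h1 : HasFDerivAt (fun y => ‖r y‖ ^ 2) _ x := hrd.hasFDerivAt.norm_sq
      have h2 : HasFDerivAt (fun y => ‖r y‖ ^ 2) (0 : E →L[ℝ] ℝ) x := by
        refine (hasFDerivAt_const (1 : ℝ) x).congr_of_eventuallyEq ?_
        filter_upwards [Metric.isOpen_ball.mem_nhds hx] with y hy
        rw [hsphere y (Metric.ball_subset_closedBall hy), one_pow]
      have h3 := congrArg (fun T : E →L[ℝ] ℝ => T v) (h1.unique h2)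
      simpa using h3
    rw [hgr]
    by_contra hne
    have hunit : IsUnit (LinearMap.det (fderiv ℝ r x : E →ₗ[ℝ] E)) := isUnit_iff_ne_zero.2 hne
    obtain ⟨v, hv⟩ := (LinearEquiv.ofIsUnitDet (v := Module.finBasis ℝ E)
      (v' := Module.finBasis ℝ E) (f := (fderiv ℝ r x : E →ₗ[ℝ] E))
      (by rwa [LinearMap.det_toMatrix])).surjective (r x)
    have hv' : fderiv ℝ r x v = r x := hv
    have h4 := horth v
    rw [hv', real_inner_self_eq_norm_sq, hsphere x hx'] at h4
    norm_num at h4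
  rw [setIntegral_congr_fun measurableSet_ball hzero] at htotal
  simp at htotal
  exact hpos.ne htotal

/-- A `C¹` map into the open unit ball has a fixed point in the closed unit ball. -/
theorem exists_fixedPoint_of_contDiff {E : Type*} [NormedAddCommGroup E]
    [InnerProductSpace ℝ E] [FiniteDimensional ℝ E] {f : E → E} (hf : ContDiff ℝ 1 f)
    (hball : ∀ x, ‖f x‖ < 1) : ∃ x ∈ Metric.closedBall (0 : E) 1, f x = x := by
  by_contra! hne
  -- The retraction follows the ray from `f x` through `x` to the sphere: `x + τ d` with `τ` the
  -- larger root of `‖d‖² τ² + 2 q τ + ‖x‖² - 1 = 0`. `D` is a quarter of the discriminant.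
  let d : E → E := fun x => x - f x
  let q : E → ℝ := fun x => inner ℝ x (d x)
  let D : E → ℝ := fun x => q x ^ 2 + ‖d x‖ ^ 2 * (1 - ‖x‖ ^ 2)
  have hd : ContDiff ℝ 1 d := contDiff_id.sub hf
  have hq : ContDiff ℝ 1 q := contDiff_id.inner ℝ hd
  have hD : ContDiff ℝ 1 D :=
    (hq.pow 2).add ((hd.norm_sq ℝ).mul (contDiff_const.sub (contDiff_id.norm_sq ℝ)))
  have hdpos : ∀ x ∈ Metric.closedBall (0 : E) 1, 0 < ‖d x‖ ^ 2 := fun x hx =>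
    pow_pos (norm_pos_iff.2 (sub_ne_zero.2 (hne x hx).symm)) 2
  -- Because `‖f x‖ < 1`, the ray leaves the ball transversally. This keeps `D` positive on the
  -- sphere, so the square root is smooth, and makes the larger root `0` there.
  have hqpos : ∀ x, ‖x‖ = 1 → 0 < q x := by
    intro x hx
    have h1 : inner ℝ x (f x) ≤ ‖x‖ * ‖f x‖ := real_inner_le_norm x (f x)
    have h2 := hball x
    simp only [q, d, inner_sub_right, real_inner_self_eq_norm_sq]
    rw [hx] at h1 ⊢
    linarith
  have hDpos : ∀ x ∈ Metric.closedBall (0 : E) 1, 0 < D x := by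
    intro x hx
    have hx1 : ‖x‖ ≤ 1 := by simpa using hx
    rcases hx1.lt_or_eq with h | h
    · have : 0 < 1 - ‖x‖ ^ 2 := by nlinarith [norm_nonneg x]
      have := mul_pos (hdpos x hx) this
      simp only [D]
      positivity
    · have := hqpos x h
      simp only [D, h]
      norm_num
      positivity
  refine not_exists_contDiffAt_retraction
    (r := fun x => x + ((√(D x) - q x) / ‖d x‖ ^ 2) • d x) (fun x hx => ?_) (fun x hx => ?_)
    fun x hx => ?_
  · exact contDiffAt_id.add ((((hD.contDiffAt.sqrt (hDpos x hx).ne').sub hq.contDiffAt).div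
      (hd.norm_sq ℝ).contDiffAt (hdpos x hx).ne').smul hd.contDiffAt)
  · have hs := Real.sq_sqrt (hDpos x hx).le
    have hN := hdpos x hx
    have hsq : ‖x + ((√(D x) - q x) / ‖d x‖ ^ 2) • d x‖ ^ 2 = 1 := by
      rw [norm_add_sq_real, real_inner_smul_right, norm_smul, mul_pow, Real.norm_eq_abs, sq_abs]
      change ‖x‖ ^ 2 + 2 * ((√(D x) - q x) / ‖d x‖ ^ 2 * q x) + _ = 1
      have hDx : D x = q x ^ 2 + ‖d x‖ ^ 2 * (1 - ‖x‖ ^ 2) := rfl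
      generalize √(D x) = e at *
      generalize ‖d x‖ ^ 2 = n at *
      field_simp
      linear_combination hs + hDx
    exact (pow_eq_one_iff_of_nonneg (norm_nonneg _) two_ne_zero).1 hsq
  · have : D x = q x ^ 2 := by simp [D, hx]
    simp only [this, Real.sqrt_sq (hqpos x hx).le, sub_self, zero_div, zero_smul, add_zero]

/-- **Brouwer fixed point theorem** for maps into the closed unit ball. -/
theorem exists_fixedPoint_of_continuous {E : Type*} [NormedAddCommGroup E]
    [InnerProductSpace ℝ E] [FiniteDimensional ℝ E] {f : E → E} (hf : Continuous f)
    (hball : ∀ x, ‖f x‖ ≤ 1) : ∃ x, f x = x := by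
  by_contra! hne
  obtain ⟨x₀, -, hmin⟩ := (isCompact_closedBall (0 : E) 1).exists_isMinOn
    (Metric.nonempty_closedBall.2 zero_le_one) (hf.sub continuous_id).norm.continuousOn
  have hpos : 0 < ‖f x₀ - x₀‖ := norm_pos_iff.2 (sub_ne_zero.2 (hne x₀))
  -- Half the least displacement. A smooth `g` within `η` of `f`, divided by `1 + η`, has a fixed
  -- point `x`; then `g x = (1 + η) x` forces `‖f x - x‖ < 2 η`, below the minimum.
  let η := ‖f x₀ - x₀‖ / 2
  have hη : 0 < η := half_pos hpos
  obtain ⟨g, hg, happrox, -⟩ := hf.exists_contDiff_approx 1 (ε := fun _ => η) continuous_const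
    fun _ => hη
  have hgn : ∀ x, ‖g x‖ < 1 + η := fun x => by
    have h1 := happrox x
    rw [dist_eq_norm] at h1
    have h2 : ‖g x‖ ≤ ‖g x - f x‖ + ‖f x‖ := by simpa using norm_add_le (g x - f x) (f x)
    linarith [hball x]
  have hη1 : 0 < 1 + η := by positivity
  obtain ⟨x, hx, hfix⟩ := exists_fixedPoint_of_contDiff (f := fun x => (1 + η)⁻¹ • g x)
    (hg.const_smul _) fun x => by
      rw [norm_smul, Real.norm_of_nonneg (by positivity), inv_mul_lt_iff₀ hη1, mul_one]
      exact hgn x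
  have hgx : g x = x + η • x := by
    have := congrArg (fun y => (1 + η) • y) hfix
    simpa [smul_smul, hη1.ne', add_smul] using this
  have h1 := happrox x
  rw [dist_comm, dist_eq_norm, hgx] at h1
  have h2 : ‖f x₀ - x₀‖ ≤ ‖f x - x‖ := hmin hx
  have h3 : ‖f x - x‖ ≤ ‖f x - (x + η • x)‖ + ‖η • x‖ := by
    have := norm_add_le (f x - (x + η • x)) (η • x)
    rwa [sub_add_eq_sub_sub, sub_add_cancel, ← sub_add_eq_sub_sub] at this
  have h4 : ‖η • x‖ ≤ η := by
    rw [norm_smul, Real.norm_of_nonneg hη.le]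
    exact mul_le_of_le_one_right hη.le (by simpa using hx)
  have h5 : 2 * η = ‖f x₀ - x₀‖ := mul_div_cancel₀ _ two_ne_zero
  linarith

/-- **Brouwer fixed point theorem** for boxes. -/
theorem exists_fixedPoint_of_mapsTo_Icc {ι : Type*} [Fintype ι] {a b : ι → ℝ} (hab : a ≤ b)
    {f : (ι → ℝ) → ι → ℝ} (hf : Continuous f)
    (hmaps : Set.MapsTo f (Set.Icc a b) (Set.Icc a b)) : ∃ x ∈ Set.Icc a b, f x = x := by
  -- Retracts the whole space onto the box. A fixed point of `f ∘ clamp` lies in the box, since `f`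
  -- maps the box into itself, and there `clamp` is the identity.
  let clamp : (ι → ℝ) → ι → ℝ := fun y => a ⊔ (b ⊓ y)
  have hclamp : ∀ y, clamp y ∈ Set.Icc a b := fun y => ⟨le_sup_left, sup_le hab inf_le_left⟩
  have hclamp_id : ∀ y ∈ Set.Icc a b, clamp y = y := fun y hy => by
    simp only [clamp, inf_eq_right.2 hy.2, sup_eq_right.2 hy.1]
  have hcc : Continuous clamp := continuous_pi fun i =>
    continuous_const.max (continuous_const.min (continuous_apply i))
  obtain ⟨C, hC⟩ := (isCompact_Icc (a := a) (b := b)).exists_bound_of_continuousOn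
    (f := fun y => (WithLp.toLp 2 y : EuclideanSpace ℝ ι))
    (PiLp.continuous_toLp 2 _).continuousOn
  -- `C` bounds the Euclidean norm on the box; the maximum with `1` only makes the scaling factor
  -- positive.
  let r := max C 1
  have hr : 0 < r := lt_max_of_lt_right one_pos
  let F : EuclideanSpace ℝ ι → EuclideanSpace ℝ ι := fun x =>
    r⁻¹ • WithLp.toLp 2 (f (clamp (r • WithLp.ofLp x)))
  have hF : Continuous F := by fun_prop
  obtain ⟨x, hx⟩ := exists_fixedPoint_of_continuous hF fun x => by
    rw [norm_smul, Real.norm_of_nonneg (by positivity), inv_mul_le_iff₀ hr, mul_one]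
    exact (hC _ (hmaps (hclamp _))).trans (le_max_left _ _)
  have hx' : f (clamp (r • WithLp.ofLp x)) = r • WithLp.ofLp x := by
    have := congrArg (fun y => r • WithLp.ofLp y) hx
    simpa [F, smul_smul, hr.ne'] using this
  have hmem : r • WithLp.ofLp x ∈ Set.Icc a b := hx' ▸ hmaps (hclamp _)
  exact ⟨_, hmem, by rwa [hclamp_id _ hmem] at hx'⟩

/-! ### Finite systems of convex constraints -/

section ConvexSystem

variable {E : Type*} [AddCommGroup E] [Module ℝ E]

/-- An affine real function on a vector space. -/
def IsAffineFun (f : E → ℝ) : Prop := ∃ (L : E →ₗ[ℝ] ℝ) (c : ℝ), ∀ x, f x = L x + c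

namespace IsAffineFun

variable {f g : E → ℝ}

theorem const (c : ℝ) : IsAffineFun fun _ : E => c := ⟨0, c, by simp⟩

theorem of_linearMap (L : E →ₗ[ℝ] ℝ) : IsAffineFun fun x => L x := ⟨L, 0, by simp⟩

theorem neg (hf : IsAffineFun f) : IsAffineFun fun x => -f x := by
  obtain ⟨L, c, h⟩ := hf
  exact ⟨-L, -c, fun x => by simp [h, add_comm]⟩

theorem add (hf : IsAffineFun f) (hg : IsAffineFun g) : IsAffineFun fun x => f x + g x := by
  obtain ⟨L, c, h⟩ := hf
  obtain ⟨L', c', h'⟩ := hg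
  exact ⟨L + L', c + c', fun x => by simp [h, h', add_add_add_comm]⟩

theorem sub (hf : IsAffineFun f) (hg : IsAffineFun g) : IsAffineFun fun x => f x - g x := by
  simpa only [sub_eq_add_neg] using hf.add hg.neg

theorem const_mul (a : ℝ) (hf : IsAffineFun f) : IsAffineFun fun x => a * f x := by
  obtain ⟨L, c, h⟩ := hf
  exact ⟨a • L, a * c, fun x => by simp [h, mul_add]⟩

theorem mul_const (hf : IsAffineFun f) (a : ℝ) : IsAffineFun fun x => f x * a := by
  simpa only [mul_comm] using hf.const_mul a

theorem apply {ι : Type*} (i : ι) : IsAffineFun fun y : ι → ℝ => y i :=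
  of_linearMap (LinearMap.proj (R := ℝ) (φ := fun _ : ι => ℝ) i)

theorem mulVec_apply {ι m n : Type*} [Fintype n] (K : Matrix m n ℝ) (e : n → ι) (i : m) :
    IsAffineFun fun y : ι → ℝ => (K *ᵥ fun b => y (e b)) i :=
  of_linearMap (LinearMap.proj i ∘ₗ K.mulVecLin ∘ₗ LinearMap.funLeft ℝ ℝ e)

theorem isQuadraticFun (hf : IsAffineFun f) : IsQuadraticFun f := by
  obtain ⟨L, c, h⟩ := hf
  exact ⟨0, L, c, fun x => by simp [h]⟩

theorem convexOn (hf : IsAffineFun f) : ConvexOn ℝ Set.univ f := by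
  obtain ⟨L, c, h⟩ := hf
  rw [show f = fun x => L x + c from funext h]
  exact (L.convexOn convex_univ).add_const c

end IsAffineFun

namespace IsQuadraticFun

variable {f g : E → ℝ}

theorem add (hf : IsQuadraticFun f) (hg : IsQuadraticFun g) :
    IsQuadraticFun fun x => f x + g x := by
  obtain ⟨Q, L, c, h⟩ := hf
  obtain ⟨Q', L', c', h'⟩ := hg
  exact ⟨Q + Q', L + L', c + c', fun x => by simp [h, h']; ring⟩

theorem neg (hf : IsQuadraticFun f) : IsQuadraticFun fun x => -f x := by
  obtain ⟨Q, L, c, h⟩ := hf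
  exact ⟨-Q, -L, -c, fun x => by simp [h]; ring⟩

theorem comp_linearMap {G : Type*} [AddCommGroup G] [Module ℝ G] (hf : IsQuadraticFun f)
    (T : G →ₗ[ℝ] E) : IsQuadraticFun fun x => f (T x) := by
  obtain ⟨Q, L, c, h⟩ := hf
  exact ⟨Q.comp T, L ∘ₗ T, c, fun x => by simp [h]⟩

theorem sq_linearMap (L : E →ₗ[ℝ] ℝ) : IsQuadraticFun fun x => L x ^ 2 :=
  ⟨QuadraticMap.sq.comp L, 0, 0, fun x => by simp [sq]⟩

end IsQuadraticFun

/-- `P` is described by finitely many constraints `F c ≤ 0` with convex functions `F c`, which are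
quadratic if `H` holds. -/
def IsConvexSystem (H : Prop) (P : E → Prop) : Prop :=
  ∃ (ι : Type) (_ : Finite ι) (F : ι → E → ℝ), (∀ y, P y ↔ ∀ c, F c y ≤ 0) ∧
    (∀ c, ConvexOn ℝ Set.univ (F c)) ∧ (H → ∀ c, IsQuadraticFun (F c))

namespace IsConvexSystem

variable {H : Prop} {P Q : E → Prop}

theorem congr (hP : IsConvexSystem H P) (h : ∀ y, Q y ↔ P y) : IsConvexSystem H Q := by
  rwa [show Q = P from funext fun y => propext (h y)]

theorem and (hP : IsConvexSystem H P) (hQ : IsConvexSystem H Q) :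
    IsConvexSystem H fun y => P y ∧ Q y := by
  obtain ⟨ι, _, F, hF, hc, hq⟩ := hP
  obtain ⟨κ, _, G, hG, hc', hq'⟩ := hQ
  refine ⟨ι ⊕ κ, inferInstance, Sum.elim F G, fun y => ?_, ?_, fun hH => ?_⟩
  · simp [hF, hG]
  · rintro (c | c)
    exacts [hc c, hc' c]
  · rintro (c | c)
    exacts [hq hH c, hq' hH c]

theorem forall_index {κ : Type} [Finite κ] {P : κ → E → Prop} (hP : ∀ k, IsConvexSystem H (P k)) :
    IsConvexSystem H fun y => ∀ k, P k y := by
  choose ι hι F hF hc hq using hP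
  refine ⟨Σ k, ι k, inferInstance, fun c => F c.1 c.2, fun y => ?_, fun c => hc _ _,
    fun hH c => hq _ hH _⟩
  simp [hF, Sigma.forall]

theorem of_sub {f g : E → ℝ} (hc : ConvexOn ℝ Set.univ fun y => f y - g y)
    (hq : H → IsQuadraticFun fun y => f y - g y) : IsConvexSystem H fun y => f y ≤ g y :=
  ⟨Unit, inferInstance, fun _ y => f y - g y, fun y => by simp, fun _ => hc, fun hH _ => hq hH⟩

theorem of_affine {f g : E → ℝ} (hf : IsAffineFun f) (hg : IsAffineFun g) :
    IsConvexSystem H fun y => f y ≤ g y :=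
  of_sub (hf.sub hg).convexOn fun _ => (hf.sub hg).isQuadraticFun

/-- The form of an envelope constraint: `T` extracts the arguments of the envelope from the decision
variables, and a linear substitution preserves both convexity and being quadratic. -/
theorem comp_le {G : Type*} [AddCommGroup G] [Module ℝ G] {h : G → ℝ} {g : E → ℝ} (T : E →ₗ[ℝ] G)
    (hc : ConvexOn ℝ Set.univ h) (hq : H → IsQuadraticFun h) (hg : IsAffineFun g) :
    IsConvexSystem H fun y => h (T y) ≤ g y := by
  refine of_sub ?_ fun hH => ?_
  · simpa only [sub_eq_add_neg] using! (hc.comp_linearMap T).add hg.neg.convexOn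
  · simpa only [sub_eq_add_neg] using ((hq hH).comp_linearMap T).add hg.neg.isQuadraticFun

theorem le_comp {G : Type*} [AddCommGroup G] [Module ℝ G] {h : G → ℝ} {g : E → ℝ} (T : E →ₗ[ℝ] G)
    (hc : ConcaveOn ℝ Set.univ h) (hq : H → IsQuadraticFun h) (hg : IsAffineFun g) :
    IsConvexSystem H fun y => g y ≤ h (T y) :=
  (comp_le T (h := fun y => -h y) hc.neg (fun hH => (hq hH).neg) hg.neg).congr fun _ =>
    neg_le_neg_iff.symm

theorem sq_add_sq_le (L L' : E →ₗ[ℝ] ℝ) (c : ℝ) :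
    IsConvexSystem H fun y => L y ^ 2 + L' y ^ 2 ≤ c := by
  refine of_sub ?_ fun _ => ?_
  · have hsq : ConvexOn ℝ Set.univ fun t : ℝ => t ^ 2 := (Even.convexOn_pow even_two)
    simpa only [sub_eq_add_neg] using!
      ((hsq.comp_linearMap L).add (hsq.comp_linearMap L')).add_const (-c)
  · simpa only [sub_eq_add_neg] using ((IsQuadraticFun.sq_linearMap L).add
      (IsQuadraticFun.sq_linearMap L')).add (IsAffineFun.const (-c)).isQuadraticFun

end IsConvexSystem

end ConvexSystem

/-! ### Convexity of the robust feasibility condition -/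

instance : Finite FlowKind :=
  Finite.of_surjective (fun b : Bool × Bool => match b with
    | (true, true) => FlowKind.pf
    | (true, false) => .qf
    | (false, true) => .pt
    | (false, false) => .qt)
    fun c => match c with
    | .pf => ⟨(true, true), rfl⟩
    | .qf => ⟨(true, false), rfl⟩
    | .pt => ⟨(false, true), rfl⟩
    | .qt => ⟨(false, false), rfl⟩

namespace PowerNetwork

variable {nb ng nd nl : ℕ}

/-- The upper (`true`) or lower (`false`) state bound as a decision variable. -/
def zVar (N : PowerNetwork nb ng nd nl) (b : Bool) (j : N.ZIdx) : N.Var :=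
  if b then .zu j else .zl j

/-- The decision variable that is the voltage of bus `k` at an upper or lower vertex. -/
def voltVar (N : PowerNetwork nb ng nd nl) (b : Bool) (k : Fin nb) : N.Var :=
  if h : ∃ i, N.genBus i = k then .u (.inr ⟨k, h⟩) else N.zVar b (.inr (.inl ⟨k, h⟩))

theorem apply_voltVar (N : PowerNetwork nb ng nd nl) (y : N.Var → ℝ) (b : Bool) (k : Fin nb) :
    y (N.voltVar b k) =
      N.volt (fun j => y (N.zVar b (.inr (.inl j)))) (fun j => y (.u j)) k := by
  unfold voltVar volt
  split <;> rfl

theorem forall_mem_vertices (N : PowerNetwork nb ng nd nl) (y : N.Var → ℝ)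
    (P : (N.ZIdx → ℝ) → Prop) :
    (∀ z ∈ ({fun j => y (.zl j), fun j => y (.zu j)} : Set (N.ZIdx → ℝ)), P z) ↔
      ∀ b, P fun j => y (N.zVar b j) := by
  simp [zVar]

/-- Every vertex coordinate is itself a decision variable, so an envelope at a vertex is a convex or
concave function after a coordinate projection. Labelling vertices by `Bool` gives an index set that
does not depend on `y`, unlike the set `{zl, zu}`. -/
theorem isConvexSystem_vertexBounds (N : PowerNetwork nb ng nd nl) {H : Prop}
    {h : (N.StateIdx → ℝ) → (N.DispIdx → ℝ) → BasisIdx nb ng nl → ℝ} {e : Envelopes nb ng nl}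
    (he : N.IsEnvelope h e) (hq : H → e.IsQuadratic) (lo up : BasisIdx nb ng nl → N.Var) :
    IsConvexSystem H fun y : N.Var → ℝ => N.VertexBounds e (fun j => y (.u j))
      (fun j => y (.zl j)) (fun j => y (.zu j)) (fun j => y (lo j)) (fun j => y (up j)) := by
  let pr (a : N.Var) : (N.Var → ℝ) →ₗ[ℝ] ℝ := LinearMap.proj a
  have hp : IsConvexSystem H fun y : N.Var → ℝ => ∀ (i : Fin ng) (b : Bool),
      y (lo (.inl i)) ≤ e.pLo i (y (.u (.inl i)), y (N.zVar b (.inr (.inr ())))) ∧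
      e.pUp i (y (.u (.inl i)), y (N.zVar b (.inr (.inr ())))) ≤ y (up (.inl i)) :=
    .forall_index fun i => .forall_index fun b =>
      (IsConvexSystem.le_comp ((pr _).prod (pr _)) (he.pLo_concave i) (fun hH => (hq hH).pLo i)
        (.apply _)).and
      (IsConvexSystem.comp_le ((pr _).prod (pr _)) (he.pUp_convex i) (fun hH => (hq hH).pUp i)
        (.apply _))
  have hcos : IsConvexSystem H fun y : N.Var → ℝ => ∀ (l : Fin nl) (a b c : Bool),
      y (lo (.inr (.inl l))) ≤ e.cosLo l (y (N.voltVar a (N.src l)), y (N.voltVar b (N.tgt l)),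
        y (N.zVar c (.inl l))) ∧
      e.cosUp l (y (N.voltVar a (N.src l)), y (N.voltVar b (N.tgt l)), y (N.zVar c (.inl l))) ≤
        y (up (.inr (.inl l))) :=
    .forall_index fun l => .forall_index fun a => .forall_index fun b => .forall_index fun c =>
      (IsConvexSystem.le_comp ((pr _).prod ((pr _).prod (pr _))) (he.cosLo_concave l)
        (fun hH => (hq hH).cosLo l) (.apply _)).and
      (IsConvexSystem.comp_le ((pr _).prod ((pr _).prod (pr _))) (he.cosUp_convex l)
        (fun hH => (hq hH).cosUp l) (.apply _))
  have hsin : IsConvexSystem H fun y : N.Var → ℝ => ∀ (l : Fin nl) (a b c : Bool),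
      y (lo (.inr (.inr (.inl l)))) ≤ e.sinLo l (y (N.voltVar a (N.src l)),
        y (N.voltVar b (N.tgt l)), y (N.zVar c (.inl l))) ∧
      e.sinUp l (y (N.voltVar a (N.src l)), y (N.voltVar b (N.tgt l)), y (N.zVar c (.inl l))) ≤
        y (up (.inr (.inr (.inl l)))) :=
    .forall_index fun l => .forall_index fun a => .forall_index fun b => .forall_index fun c =>
      (IsConvexSystem.le_comp ((pr _).prod ((pr _).prod (pr _))) (he.sinLo_concave l)
        (fun hH => (hq hH).sinLo l) (.apply _)).and
      (IsConvexSystem.comp_le ((pr _).prod ((pr _).prod (pr _))) (he.sinUp_convex l)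
        (fun hH => (hq hH).sinUp l) (.apply _))
  have hv : IsConvexSystem H fun y : N.Var → ℝ => ∀ (k : Fin nb) (b : Bool),
      y (lo (.inr (.inr (.inr k)))) ≤ e.vLo k (y (N.voltVar b k)) ∧
      e.vUp k (y (N.voltVar b k)) ≤ y (up (.inr (.inr (.inr k)))) :=
    .forall_index fun k => .forall_index fun b =>
      (IsConvexSystem.le_comp (pr _) (he.vLo_concave k) (fun hH => (hq hH).vLo k)
        (.apply _)).and
      (IsConvexSystem.comp_le (pr _) (he.vUp_convex k) (fun hH => (hq hH).vUp k) (.apply _))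
  refine (hp.and (hcos.and (hsin.and hv))).congr fun y => ?_
  simp only [apply_voltVar]
  constructor
  · rintro ⟨h1, h2, h3, h4⟩
    simp only [forall_mem_vertices] at h1 h2 h3 h4
    exact ⟨h1, h2, h3, h4⟩
  · rintro ⟨h1, h2, h3, h4⟩
    constructor <;> simp only [forall_mem_vertices] <;> assumption

theorem isAffineFun_xi (N : PowerNetwork nb ng nd nl) {E : Type*} [AddCommGroup E] [Module ℝ E]
    (Jinv : Matrix N.StateIdx N.EqIdx ℝ) (w0 : UncIdx nd → ℝ)
    (S : Matrix (UncIdx nd) (UncIdx nd) ℝ) {γ : E → ℝ} (hγ : IsAffineFun γ) (j : N.ZIdx) :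
    IsAffineFun fun y => N.xi Jinv w0 S (γ y) j :=
  (IsAffineFun.const _).add (hγ.mul_const _)

theorem isAffineFun_zeta (N : PowerNetwork nb ng nd nl) {E : Type*} [AddCommGroup E] [Module ℝ E]
    (w0 : UncIdx nd → ℝ) (S : Matrix (UncIdx nd) (UncIdx nd) ℝ) {γ : E → ℝ} (hγ : IsAffineFun γ)
    (k : N.PVBus) : IsAffineFun fun y => N.zeta w0 S (γ y) k :=
  (IsAffineFun.const _).add (hγ.mul_const _)

/-- Apart from the vertex bounds and the two families of squared line limits, every constraint is
affine. -/
theorem isConvexSystem_robustCondition (N : PowerNetwork nb ng nd nl) {H : Prop}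
    (Jinv : Matrix N.StateIdx N.EqIdx ℝ) (w0 : UncIdx nd → ℝ)
    (S : Matrix (UncIdx nd) (UncIdx nd) ℝ) {eg eψ : Envelopes nb ng nl}
    {hg hψ : (N.StateIdx → ℝ) → (N.DispIdx → ℝ) → BasisIdx nb ng nl → ℝ}
    (heg : N.IsEnvelope hg eg) (heψ : N.IsEnvelope hψ eψ)
    (hqg : H → eg.IsQuadratic) (hqψ : H → eψ.IsQuadratic) :
    IsConvexSystem H fun y : N.Var → ℝ => N.RobustCondition Jinv w0 S eg eψ y := by
  let pr (a : N.Var) : (N.Var → ℝ) →ₗ[ℝ] ℝ := LinearMap.proj a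
  have hγ : IsAffineFun fun y : N.Var → ℝ => y .gamma := .apply _
  have h1 : IsConvexSystem H fun y : N.Var → ℝ => ∀ j, y (.zl j) ≤ y (.zu j) :=
    .forall_index fun j => .of_affine (.apply _) (.apply _)
  have h2 := N.isConvexSystem_vertexBounds heg hqg .gl .gu
  have h3 := N.isConvexSystem_vertexBounds heψ hqψ .psil .psiu
  have h4 : IsConvexSystem H fun y : N.Var → ℝ => ∀ j,
      (posEntries (N.K Jinv) *ᵥ fun b => y (.gu b)) j +
      (negEntries (N.K Jinv) *ᵥ fun b => y (.gl b)) j + N.xi Jinv w0 S (y .gamma) j ≤ y (.zu j) :=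
    .forall_index fun j => .of_affine (((IsAffineFun.mulVec_apply _ _ _).add
      (IsAffineFun.mulVec_apply _ _ _)).add (N.isAffineFun_xi _ _ _ hγ _)) (.apply _)
  have h5 : IsConvexSystem H fun y : N.Var → ℝ => ∀ j,
      y (.zl j) ≤ (posEntries (N.K Jinv) *ᵥ fun b => y (.gl b)) j +
      (negEntries (N.K Jinv) *ᵥ fun b => y (.gu b)) j + N.xi Jinv w0 S (-y .gamma) j :=
    .forall_index fun j => .of_affine (.apply _) (((IsAffineFun.mulVec_apply _ _ _).add
      (IsAffineFun.mulVec_apply _ _ _)).add (N.isAffineFun_xi _ _ _ hγ.neg _))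
  have h6 : IsConvexSystem H fun y : N.Var → ℝ => ∀ i,
      N.pMin i ≤ y (.u (.inl i)) + N.α i * y (.zl (.inr (.inr ()))) :=
    .forall_index fun i => .of_affine (.const _) ((IsAffineFun.apply _).add
      ((IsAffineFun.apply _).const_mul _))
  have h7 : IsConvexSystem H fun y : N.Var → ℝ => ∀ i,
      y (.u (.inl i)) + N.α i * y (.zu (.inr (.inr ()))) ≤ N.pMax i :=
    .forall_index fun i => .of_affine ((IsAffineFun.apply _).add
      ((IsAffineFun.apply _).const_mul _)) (.const _)
  have hlb {κ : Type} [Finite κ] (a : κ → ℝ) (e : κ → N.Var) :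
      IsConvexSystem H fun y : N.Var → ℝ => ∀ i, a i ≤ y (e i) :=
    .forall_index fun i => .of_affine (.const _) (.apply _)
  have hub {κ : Type} [Finite κ] (a : κ → ℝ) (e : κ → N.Var) :
      IsConvexSystem H fun y : N.Var → ℝ => ∀ i, y (e i) ≤ a i :=
    .forall_index fun i => .of_affine (.apply _) (.const _)
  have hline (c c' : FlowKind) : IsConvexSystem H fun y : N.Var → ℝ =>
      ∀ l, y (.s c l) ^ 2 + y (.s c' l) ^ 2 ≤ N.sMax l ^ 2 :=
    .forall_index fun l => .sq_add_sq_le (pr (.s c l)) (pr (.s c' l)) _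
  have h8 : IsConvexSystem H fun y : N.Var → ℝ => ∀ k : N.PVBus,
      (posEntries N.Lq *ᵥ fun b => y (.psiu b)) k +
      (negEntries N.Lq *ᵥ fun b => y (.psil b)) k + N.zeta w0 S (y .gamma) k ≤
      (N.Cg *ᵥ fun i => y (.qu i)) k :=
    .forall_index fun k => .of_affine (((IsAffineFun.mulVec_apply _ _ _).add
      (IsAffineFun.mulVec_apply _ _ _)).add (N.isAffineFun_zeta _ _ hγ _))
      (IsAffineFun.mulVec_apply _ _ _)
  have h9 : IsConvexSystem H fun y : N.Var → ℝ => ∀ k : N.PVBus,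
      (N.Cg *ᵥ fun i => y (.ql i)) k ≤
      (negEntries N.Lq *ᵥ fun b => y (.psiu b)) k +
      (posEntries N.Lq *ᵥ fun b => y (.psil b)) k + N.zeta w0 S (-y .gamma) k :=
    .forall_index fun k => .of_affine (IsAffineFun.mulVec_apply _ _ _)
      (((IsAffineFun.mulVec_apply _ _ _).add
      (IsAffineFun.mulVec_apply _ _ _)).add (N.isAffineFun_zeta _ _ hγ.neg _))
  have h10 : IsConvexSystem H fun y : N.Var → ℝ => ∀ c l,
      (posEntries (N.Lline c) *ᵥ fun b => y (.psiu b)) l +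
      (negEntries (N.Lline c) *ᵥ fun b => y (.psil b)) l ≤ y (.s c l) :=
    .forall_index fun c => .forall_index fun l => .of_affine ((IsAffineFun.mulVec_apply _ _ _).add
      (IsAffineFun.mulVec_apply _ _ _)) (.apply _)
  have h11 : IsConvexSystem H fun y : N.Var → ℝ => ∀ c l,
      -(negEntries (N.Lline c) *ᵥ fun b => y (.psiu b)) l -
      (posEntries (N.Lline c) *ᵥ fun b => y (.psil b)) l ≤ y (.s c l) :=
    .forall_index fun c => .forall_index fun l => .of_affine
      ((IsAffineFun.mulVec_apply _ _ _).neg.sub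
      (IsAffineFun.mulVec_apply _ _ _)) (.apply _)
  refine (h1.and <| h2.and <| h3.and <| h4.and <| h5.and <| h6.and <| h7.and <|
    (hlb N.qMin .ql).and <| (hub N.qMax .qu).and <|
    (hlb (fun k : N.PQBus => N.vMin k) fun k => .zl (.inr (.inl k))).and <|
    (hub (fun k : N.PQBus => N.vMax k) fun k => .zu (.inr (.inl k))).and <|
    (hlb (fun k : N.PVBus => N.vMin k) fun k => .u (.inr k)).and <|
    (hub (fun k : N.PVBus => N.vMax k) fun k => .u (.inr k)).and <|
    (hlb N.phiMin fun l => .zl (.inl l)).and <| (hub N.phiMax fun l => .zu (.inl l)).and <|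
    (hline .pf .qf).and <| (hline .pt .qt).and <| h8.and <| h9.and <| h10.and h11).congr
    fun y => ⟨?_, ?_⟩
  · rintro ⟨a1, a2, a3, a4, a5, a6, a7, a8, a9, a10, a11, a12, a13, a14, a15, a16, a17, a18, a19,
      a20, a21⟩
    exact ⟨a1, a2, a3, a4, a5, a6, a7, a8, a9, a10, a11, a12, a13, a14, a15, a16, a17, a18, a19,
      a20, a21⟩
  · rintro ⟨a1, a2, a3, a4, a5, a6, a7, a8, a9, a10, a11, a12, a13, a14, a15, a16, a17, a18, a19,
      a20, a21⟩
    exact ⟨a1, a2, a3, a4, a5, a6, a7, a8, a9, a10, a11, a12, a13, a14, a15, a16, a17, a18, a19,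
      a20, a21⟩

end PowerNetwork

/-! ### Interval bounds, ellipsoids and vertices of boxes -/

/-- `K` is the sum of its positive part, which is monotone, and its negative part, which is
antitone. -/
theorem mulVec_le_posEntries_add_negEntries {m n : Type*} [Fintype n] (K : Matrix m n ℝ)
    {lo up g : n → ℝ} (hg : g ∈ Set.Icc lo up) (i : m) :
    (K *ᵥ g) i ≤ (posEntries K *ᵥ up) i + (negEntries K *ᵥ lo) i := by
  simp only [mulVec, dotProduct, posEntries, negEntries, ← Finset.sum_add_distrib]
  refine Finset.sum_le_sum fun j _ => ?_
  have h1 := mul_le_mul_of_nonneg_left (hg.2 j) (le_max_right (K i j) 0)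
  have h2 := mul_le_mul_of_nonpos_left (hg.1 j) (min_le_right (K i j) 0)
  have h3 : K i j * g j = max (K i j) 0 * g j + min (K i j) 0 * g j := by
    rw [← add_mul, max_add_min, add_zero]
  linarith

theorem posEntries_add_negEntries_le_mulVec {m n : Type*} [Fintype n] (K : Matrix m n ℝ)
    {lo up g : n → ℝ} (hg : g ∈ Set.Icc lo up) (i : m) :
    (posEntries K *ᵥ lo) i + (negEntries K *ᵥ up) i ≤ (K *ᵥ g) i := by
  have h := mulVec_le_posEntries_add_negEntries K (lo := -up) (up := -lo) (g := -g)
    ⟨neg_le_neg hg.2, neg_le_neg hg.1⟩ i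
  simp only [mulVec_neg, Pi.neg_apply] at h
  linarith

/-- The range of a linear function over the ellipsoid. -/
theorem abs_mulVec_sub_le_of_mem_ellipsoid {nd : ℕ} {m : Type*} {w0 w : UncIdx nd → ℝ}
    {Sig S : Matrix (UncIdx nd) (UncIdx nd) ℝ} (hSig : Sig.PosDef) (hS : Sig = S * Sᵀ) {γ : ℝ}
    (hγ : 0 ≤ γ) (hw : w ∈ ellipsoid w0 Sig γ) (B : Matrix m (UncIdx nd) ℝ) (i : m) :
    |(B *ᵥ (w - w0)) i| ≤ γ * rowNorm (B * S) i := by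
  -- `S` may be any square factor of `Sig`; `det Sig = (det S)² > 0` makes it invertible.
  have hdet : IsUnit S.det := by
    have h := hSig.det_pos
    rw [hS, det_mul, det_transpose] at h
    exact isUnit_iff_ne_zero.2 fun h0 => by simp [h0] at h
  -- In this coordinate the ellipsoid is the ball of radius `γ`, and Cauchy-Schwarz with the rows of
  -- `B * S` finishes.
  let e := S⁻¹ *ᵥ (w - w0)
  have he : S *ᵥ e = w - w0 := by
    rw [mulVec_mulVec, mul_nonsing_inv _ hdet, one_mulVec]
  have hnorm : e ⬝ᵥ e ≤ γ ^ 2 := by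
    have h : (w - w0) ⬝ᵥ (Sig⁻¹ *ᵥ (w - w0)) = e ⬝ᵥ e := by
      rw [hS, Matrix.mul_inv_rev, ← transpose_nonsing_inv, ← mulVec_mulVec, dotProduct_mulVec,
        vecMul_transpose]
    exact h ▸ hw
  have hinner : (B *ᵥ (w - w0)) i =
      inner ℝ (WithLp.toLp 2 e : EuclideanSpace ℝ (UncIdx nd))
        (WithLp.toLp 2 fun j => (B * S) i j) := by
    rw [← he, mulVec_mulVec, EuclideanSpace.inner_toLp_toLp]
    rfl
  have hen : ‖(WithLp.toLp 2 e : EuclideanSpace ℝ (UncIdx nd))‖ ≤ γ := by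
    refine abs_le_of_sq_le_sq' ?_ hγ |>.2
    rw [EuclideanSpace.real_norm_sq_eq]
    simpa [dotProduct, sq] using hnorm
  rw [hinner]
  exact (abs_real_inner_le_norm _ _).trans (mul_le_mul_of_nonneg_right hen (norm_nonneg _))

theorem ConvexOn.le_of_mem_Icc {f : ℝ → ℝ} (hf : ConvexOn ℝ Set.univ f) {l u x c : ℝ}
    (hx : x ∈ Set.Icc l u) (hl : f l ≤ c) (hu : f u ≤ c) : f x ≤ c :=
  (hf.le_max_of_mem_Icc (Set.mem_univ l) (Set.mem_univ u) hx).trans (max_le hl hu)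

theorem ConvexOn.le_of_mem_Icc_snd {f : ℝ × ℝ → ℝ} (hf : ConvexOn ℝ Set.univ f) {a l u x c : ℝ}
    (hx : x ∈ Set.Icc l u) (hl : f (a, l) ≤ c) (hu : f (a, u) ≤ c) : f (a, x) ≤ c := by
  let T : ℝ →ᵃ[ℝ] ℝ × ℝ := (AffineMap.const ℝ ℝ a).prod (AffineMap.id ℝ ℝ)
  exact (hf.comp_affineMap T).le_of_mem_Icc (f := f ∘ T) hx hl hu

/-- A convex function of three variables is bounded on a box by its values at the vertices, which
are given by families of functions `a, b, c` at `z ∈ {l, u}`. -/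
theorem ConvexOn.le_of_mem_box {ζ : Type*} {l u : ζ} {f : ℝ × ℝ × ℝ → ℝ}
    (hf : ConvexOn ℝ Set.univ f) {a b c : ζ → ℝ} {x y z C : ℝ}
    (hx : x ∈ Set.Icc (a l) (a u)) (hy : y ∈ Set.Icc (b l) (b u)) (hz : z ∈ Set.Icc (c l) (c u))
    (h : ∀ p ∈ ({l, u} : Set ζ), ∀ q ∈ ({l, u} : Set ζ), ∀ r ∈ ({l, u} : Set ζ),
      f (a p, b q, c r) ≤ C) : f (x, y, z) ≤ C := by
  have hl : l ∈ ({l, u} : Set ζ) := by simp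
  have hu : u ∈ ({l, u} : Set ζ) := by simp
  -- One coordinate is released at a time, the last one first, each by convexity on an interval.
  have h1 : ∀ p ∈ ({l, u} : Set ζ), ∀ q ∈ ({l, u} : Set ζ), f (a p, b q, z) ≤ C := by
    intro p hp q hq
    let T : ℝ →ᵃ[ℝ] ℝ × ℝ × ℝ :=
      (AffineMap.const ℝ ℝ (a p)).prod ((AffineMap.const ℝ ℝ (b q)).prod (AffineMap.id ℝ ℝ))
    exact (hf.comp_affineMap T).le_of_mem_Icc (f := f ∘ T) hz (h p hp q hq l hl) (h p hp q hq u hu)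
  have h2 : ∀ p ∈ ({l, u} : Set ζ), f (a p, y, z) ≤ C := by
    intro p hp
    let T : ℝ →ᵃ[ℝ] ℝ × ℝ × ℝ :=
      (AffineMap.const ℝ ℝ (a p)).prod ((AffineMap.id ℝ ℝ).prod (AffineMap.const ℝ ℝ z))
    exact (hf.comp_affineMap T).le_of_mem_Icc (f := f ∘ T) hy (h1 p hp l hl) (h1 p hp u hu)
  let T : ℝ →ᵃ[ℝ] ℝ × ℝ × ℝ :=
    (AffineMap.id ℝ ℝ).prod ((AffineMap.const ℝ ℝ y).prod (AffineMap.const ℝ ℝ z))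
  exact (hf.comp_affineMap T).le_of_mem_Icc (f := f ∘ T) hx (h2 l hl) (h2 u hu)

namespace PowerNetwork

variable {nb ng nd nl : ℕ} (N : PowerNetwork nb ng nd nl)

/-! ### The transformed state -/

theorem theta_eq_sum (x : N.StateIdx → ℝ) (k : Fin nb) :
    N.theta x k = ∑ j : N.NSBus, (if k = j then 1 else 0) * x (.inl j) := by
  unfold theta
  split_ifs with h
  · subst h
    exact (Finset.sum_eq_zero fun j _ => by rw [if_neg (Ne.symm j.2), zero_mul]).symm
  · rw [Finset.sum_eq_single ⟨k, h⟩]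
    · simp
    · intro j _ hj
      rw [if_neg fun hk => hj (Subtype.ext hk.symm), zero_mul]
    · simp

theorem A_mulVec_inl (x : N.StateIdx → ℝ) (l : Fin nl) : (N.A *ᵥ x) (.inl l) = N.phi x l := by
  rw [phi, theta_eq_sum, theta_eq_sum, ← Finset.sum_sub_distrib]
  simp [A, mulVec, dotProduct, Fintype.sum_sum_type, E, Ef, Et, sub_mul]

theorem A_mulVec_inr (x : N.StateIdx → ℝ) (j : N.PQBus ⊕ Unit) :
    (N.A *ᵥ x) (.inr j) = x (.inr j) := by
  rw [A, fromBlocks_mulVec]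
  simp

/-- Voltages are between those of the vertices. -/
theorem volt_mem_Icc {a b c : N.PQBus → ℝ} (h : c ∈ Set.Icc a b) (u : N.DispIdx → ℝ) (k : Fin nb) :
    N.volt c u k ∈ Set.Icc (N.volt a u k) (N.volt b u k) := by
  unfold volt
  split_ifs with hk
  · exact ⟨le_rfl, le_rfl⟩
  · exact ⟨h.1 _, h.2 _⟩

/-- Prescribed voltages, imbalance and angle difference along one line. -/
theorem exists_state_eq (z : N.ZIdx → ℝ) (l : Fin nl) :
    ∃ x : N.StateIdx → ℝ, N.phi x l = z (.inl l) ∧ ∀ j, x (.inr j) = z (.inr j) := by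
  -- The reference angle is pinned to zero, so an end that is not the reference carries the
  -- difference, with a minus sign if it is the to bus.
  by_cases h : N.src l = N.ref
  · have ht : N.tgt l ≠ N.ref := fun ht => N.src_ne_tgt l (h.trans ht.symm)
    refine ⟨Sum.elim (fun _ => -z (.inl l)) fun j => z (.inr j), ?_, fun j => rfl⟩
    simp [phi, theta, h, ht]
  · refine ⟨Sum.elim (fun k => if k = N.src l then z (.inl l) else 0) fun j => z (.inr j), ?_,
      fun j => rfl⟩
    simp [phi, theta, h, (N.src_ne_tgt l).symm]

/-! ### Differentiability of the basis functions -/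

theorem differentiable_theta (k : Fin nb) : Differentiable ℝ fun x => N.theta x k := by
  unfold theta
  split_ifs <;> fun_prop

theorem differentiable_phi (l : Fin nl) : Differentiable ℝ fun x => N.phi x l :=
  (N.differentiable_theta _).sub (N.differentiable_theta _)

theorem differentiable_v (u : N.DispIdx → ℝ) (k : Fin nb) :
    Differentiable ℝ fun x => N.v x u k := by
  unfold v volt
  split_ifs <;> fun_prop

theorem differentiable_psi (u : N.DispIdx → ℝ) : Differentiable ℝ fun x => N.psi x u := by
  have hv := N.differentiable_v u
  have hphi := N.differentiable_phi
  refine differentiable_pi.2 fun b => ?_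
  rcases b with i | l | l | k
  · simp only [psi, pg, imb]
    fun_prop
  · exact ((hv _).mul (hv _)).mul (hphi l).cos
  · exact ((hv _).mul (hv _)).mul (hphi l).sin
  · exact (hv k).pow 2

/-- Chain rule; the term `R w` is constant in `x`. This identity lets the linear part of `ψ` be
inverted by `Jinv`. -/
theorem Jf_mulVec (x0 : N.StateIdx → ℝ) (u0 : N.DispIdx → ℝ) (w0 : UncIdx nd → ℝ)
    (x : N.StateIdx → ℝ) : N.Jf x0 u0 w0 *ᵥ x = N.M *ᵥ (N.Jpsi x0 u0 *ᵥ x) := by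
  have h : HasFDerivAt (fun x => N.f x u0 w0)
      ((N.M.mulVecLin.toContinuousLinearMap).comp (fderiv ℝ (fun x => N.psi x u0) x0)) x0 :=
    ((N.M.mulVecLin.toContinuousLinearMap.hasFDerivAt).comp x0
      (N.differentiable_psi u0 x0).hasFDerivAt).add_const _
  rw [Jf, Jpsi, h.fderiv, LinearMap.toMatrix'_mulVec, LinearMap.toMatrix'_mulVec]
  rfl

theorem continuous_resid (x0 : N.StateIdx → ℝ) (u0 u : N.DispIdx → ℝ) :
    Continuous fun x => N.resid x0 u0 x u :=
  (N.differentiable_psi u).continuous.sub (continuous_const.matrix_mulVec continuous_id)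

end PowerNetwork

namespace PowerNetwork

variable {nb ng nd nl : ℕ} (N : PowerNetwork nb ng nd nl)

/-! ### Bounds on the enveloped functions -/

section Bounds

variable {N} {h : (N.StateIdx → ℝ) → (N.DispIdx → ℝ) → BasisIdx nb ng nl → ℝ}
  {e : Envelopes nb ng nl} {u : N.DispIdx → ℝ} {zl zu : N.ZIdx → ℝ}
  {lo up : BasisIdx nb ng nl → ℝ} {x : N.StateIdx → ℝ}

/-- The operational limits hold at all vertices of the box `[zl, zu]`. -/
structure BoxWithinLimits (N : PowerNetwork nb ng nd nl) (u : N.DispIdx → ℝ)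
    (zl zu : N.ZIdx → ℝ) : Prop where
  p_lower : ∀ i, N.pMin i ≤ u (.inl i) + N.α i * zl (.inr (.inr ()))
  p_upper : ∀ i, u (.inl i) + N.α i * zu (.inr (.inr ())) ≤ N.pMax i
  vpq_lower : ∀ k : N.PQBus, N.vMin k ≤ zl (.inr (.inl k))
  vpq_upper : ∀ k : N.PQBus, zu (.inr (.inl k)) ≤ N.vMax k
  vg_lower : ∀ k : N.PVBus, N.vMin k ≤ u (.inr k)
  vg_upper : ∀ k : N.PVBus, u (.inr k) ≤ N.vMax k
  phi_lower : ∀ l, N.phiMin l ≤ zl (.inl l)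
  phi_upper : ∀ l, zu (.inl l) ≤ N.phiMax l

theorem BoxWithinLimits.pg_mem (hlim : N.BoxWithinLimits u zl zu)
    (hx : ∀ j, x (.inr j) ∈ Set.Icc (zl (.inr j)) (zu (.inr j))) (i : Fin ng) :
    N.pg x u i ∈ Set.Icc (N.pMin i) (N.pMax i) := by
  have h1 := mul_le_mul_of_nonneg_left (hx (.inr ())).1 (N.α_nonneg i)
  have h2 := mul_le_mul_of_nonneg_left (hx (.inr ())).2 (N.α_nonneg i)
  have h3 := hlim.p_lower i
  have h4 := hlim.p_upper i
  simp only [pg, imb, Set.mem_Icc]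
  constructor <;> linarith

theorem v_mem_Icc (hx : ∀ j, x (.inr j) ∈ Set.Icc (zl (.inr j)) (zu (.inr j))) (k : Fin nb) :
    N.v x u k ∈ Set.Icc (N.volt (fun j => zl (.inr (.inl j))) u k)
      (N.volt (fun j => zu (.inr (.inl j))) u k) :=
  N.volt_mem_Icc ⟨fun j => (hx (.inl j)).1, fun j => (hx (.inl j)).2⟩ u k

theorem BoxWithinLimits.v_mem (hlim : N.BoxWithinLimits u zl zu)
    (hx : ∀ j, x (.inr j) ∈ Set.Icc (zl (.inr j)) (zu (.inr j))) (k : Fin nb) :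
    N.v x u k ∈ Set.Icc (N.vMin k) (N.vMax k) := by
  unfold v volt
  split_ifs with hk
  · exact ⟨hlim.vg_lower ⟨k, hk⟩, hlim.vg_upper ⟨k, hk⟩⟩
  · exact ⟨(hlim.vpq_lower ⟨k, hk⟩).trans (hx (.inl ⟨k, hk⟩)).1,
      (hx (.inl ⟨k, hk⟩)).2.trans (hlim.vpq_upper ⟨k, hk⟩)⟩

theorem BoxWithinLimits.phi_mem (hlim : N.BoxWithinLimits u zl zu) {l : Fin nl}
    (hφ : N.phi x l ∈ Set.Icc (zl (.inl l)) (zu (.inl l))) :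
    N.phi x l ∈ Set.Icc (N.phiMin l) (N.phiMax l) :=
  ⟨(hlim.phi_lower l).trans hφ.1, hφ.2.trans (hlim.phi_upper l)⟩

/-- The pattern of all four blocks: the limits make the envelopes valid at `x`, and convexity bounds
them by their vertex values, with lower envelopes negated. Only the coordinates that the block
depends on are constrained, which `IsEnvelope.lo_le_up` needs. -/
theorem IsEnvelope.p_mem (he : N.IsEnvelope h e) (hv : N.VertexBounds e u zl zu lo up)
    (hlim : N.BoxWithinLimits u zl zu)
    (hx : ∀ j, x (.inr j) ∈ Set.Icc (zl (.inr j)) (zu (.inr j))) (i : Fin ng) :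
    h x u (.inl i) ∈ Set.Icc (lo (.inl i)) (up (.inl i)) := by
  have hb := he.p_bound x u i (hlim.pg_mem hx i)
  have h1 := hv.p i zl (by simp)
  have h2 := hv.p i zu (by simp)
  refine ⟨le_trans ?_ hb.1, hb.2.trans ?_⟩
  · exact neg_le_neg_iff.1 ((he.pLo_concave i).neg.le_of_mem_Icc_snd (hx (.inr ()))
      (neg_le_neg h1.1) (neg_le_neg h2.1))
  · exact (he.pUp_convex i).le_of_mem_Icc_snd (hx (.inr ())) h1.2 h2.2

theorem IsEnvelope.v_mem (he : N.IsEnvelope h e) (hv : N.VertexBounds e u zl zu lo up)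
    (hlim : N.BoxWithinLimits u zl zu)
    (hx : ∀ j, x (.inr j) ∈ Set.Icc (zl (.inr j)) (zu (.inr j))) (k : Fin nb) :
    h x u (.inr (.inr (.inr k))) ∈
      Set.Icc (lo (.inr (.inr (.inr k)))) (up (.inr (.inr (.inr k)))) := by
  have hb := he.v_bound x u k (hlim.v_mem hx k)
  have h1 := hv.v k zl (by simp)
  have h2 := hv.v k zu (by simp)
  refine ⟨le_trans ?_ hb.1, hb.2.trans ?_⟩
  · exact neg_le_neg_iff.1 ((he.vLo_concave k).neg.le_of_mem_Icc (v_mem_Icc hx k)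
      (neg_le_neg h1.1) (neg_le_neg h2.1))
  · exact (he.vUp_convex k).le_of_mem_Icc (v_mem_Icc hx k) h1.2 h2.2

theorem IsEnvelope.cos_mem (he : N.IsEnvelope h e) (hv : N.VertexBounds e u zl zu lo up)
    (hlim : N.BoxWithinLimits u zl zu)
    (hx : ∀ j, x (.inr j) ∈ Set.Icc (zl (.inr j)) (zu (.inr j))) {l : Fin nl}
    (hφ : N.phi x l ∈ Set.Icc (zl (.inl l)) (zu (.inl l))) :
    h x u (.inr (.inl l)) ∈ Set.Icc (lo (.inr (.inl l))) (up (.inr (.inl l))) := by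
  have hb := he.cos_bound x u l (hlim.v_mem hx _) (hlim.v_mem hx _) (hlim.phi_mem hφ)
  refine ⟨le_trans ?_ hb.1, hb.2.trans ?_⟩
  · exact neg_le_neg_iff.1 ((he.cosLo_concave l).neg.le_of_mem_box
      (a := fun z => N.volt (fun j => z (.inr (.inl j))) u (N.src l))
      (b := fun z => N.volt (fun j => z (.inr (.inl j))) u (N.tgt l)) (c := fun z => z (.inl l))
      (v_mem_Icc hx _) (v_mem_Icc hx _) hφ
      fun p hp q hq r hr => neg_le_neg (hv.cos l p hp q hq r hr).1)
  · exact (he.cosUp_convex l).le_of_mem_box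
      (a := fun z => N.volt (fun j => z (.inr (.inl j))) u (N.src l))
      (b := fun z => N.volt (fun j => z (.inr (.inl j))) u (N.tgt l)) (c := fun z => z (.inl l))
      (v_mem_Icc hx _) (v_mem_Icc hx _) hφ fun p hp q hq r hr => (hv.cos l p hp q hq r hr).2

theorem IsEnvelope.sin_mem (he : N.IsEnvelope h e) (hv : N.VertexBounds e u zl zu lo up)
    (hlim : N.BoxWithinLimits u zl zu)
    (hx : ∀ j, x (.inr j) ∈ Set.Icc (zl (.inr j)) (zu (.inr j))) {l : Fin nl}
    (hφ : N.phi x l ∈ Set.Icc (zl (.inl l)) (zu (.inl l))) :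
    h x u (.inr (.inr (.inl l))) ∈
      Set.Icc (lo (.inr (.inr (.inl l)))) (up (.inr (.inr (.inl l)))) := by
  have hb := he.sin_bound x u l (hlim.v_mem hx _) (hlim.v_mem hx _) (hlim.phi_mem hφ)
  refine ⟨le_trans ?_ hb.1, hb.2.trans ?_⟩
  · exact neg_le_neg_iff.1 ((he.sinLo_concave l).neg.le_of_mem_box
      (a := fun z => N.volt (fun j => z (.inr (.inl j))) u (N.src l))
      (b := fun z => N.volt (fun j => z (.inr (.inl j))) u (N.tgt l)) (c := fun z => z (.inl l))
      (v_mem_Icc hx _) (v_mem_Icc hx _) hφ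
      fun p hp q hq r hr => neg_le_neg (hv.sin l p hp q hq r hr).1)
  · exact (he.sinUp_convex l).le_of_mem_box
      (a := fun z => N.volt (fun j => z (.inr (.inl j))) u (N.src l))
      (b := fun z => N.volt (fun j => z (.inr (.inl j))) u (N.tgt l)) (c := fun z => z (.inl l))
      (v_mem_Icc hx _) (v_mem_Icc hx _) hφ fun p hp q hq r hr => (hv.sin l p hp q hq r hr).2

/-- The vertex bounds hold for all states in the box. -/
theorem IsEnvelope.mem_Icc (he : N.IsEnvelope h e) (hv : N.VertexBounds e u zl zu lo up)
    (hlim : N.BoxWithinLimits u zl zu) (hx : N.A *ᵥ x ∈ Set.Icc zl zu) :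
    h x u ∈ Set.Icc lo up := by
  have hr : ∀ j, x (.inr j) ∈ Set.Icc (zl (.inr j)) (zu (.inr j)) := fun j => by
    rw [← N.A_mulVec_inr x j]
    exact ⟨hx.1 _, hx.2 _⟩
  have hφ : ∀ l, N.phi x l ∈ Set.Icc (zl (.inl l)) (zu (.inl l)) := fun l => by
    rw [← N.A_mulVec_inl x l]
    exact ⟨hx.1 _, hx.2 _⟩
  have key : ∀ b, h x u b ∈ Set.Icc (lo b) (up b) := by
    rintro (i | l | l | k)
    exacts [he.p_mem hv hlim hr i, he.cos_mem hv hlim hr (hφ l), he.sin_mem hv hlim hr (hφ l),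
      he.v_mem hv hlim hr k]
  exact ⟨fun b => (key b).1, fun b => (key b).2⟩

/-- The box of function values is nonempty. -/
theorem IsEnvelope.lo_le_up (he : N.IsEnvelope h e) (hv : N.VertexBounds e u zl zu lo up)
    (hlim : N.BoxWithinLimits u zl zu) (hz : zl ≤ zu) : lo ≤ up := by
  -- A state with `A x` in the whole box is not yet available, as prescribed angle differences may
  -- be inconsistent around a cycle. Each component therefore gets a state of its own that lies in
  -- the box in the relevant coordinates.
  have hbus : ∀ {x : N.StateIdx → ℝ}, (∀ j, x (.inr j) = zl (.inr j)) →
      ∀ j, x (.inr j) ∈ Set.Icc (zl (.inr j)) (zu (.inr j)) := fun hx j => by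
    rw [hx]
    exact ⟨le_rfl, hz _⟩
  have hx0 := hbus (x := Sum.elim (fun _ => 0) fun j => zl (.inr j)) fun _ => rfl
  rintro (i | l | l | k)
  · exact (Set.nonempty_Icc.1 ⟨_, he.p_mem hv hlim hx0 i⟩)
  · obtain ⟨x, hφ, hx⟩ := N.exists_state_eq zl l
    exact (Set.nonempty_Icc.1 ⟨_, he.cos_mem hv hlim (hbus hx) ⟨hφ.ge, hφ.trans_le (hz _)⟩⟩)
  · obtain ⟨x, hφ, hx⟩ := N.exists_state_eq zl l
    exact (Set.nonempty_Icc.1 ⟨_, he.sin_mem hv hlim (hbus hx) ⟨hφ.ge, hφ.trans_le (hz _)⟩⟩)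
  · exact (Set.nonempty_Icc.1 ⟨_, he.v_mem hv hlim hx0 k⟩)

end Bounds

/-! ### Solvability of the power flow equations -/

/-- Fixed points of the Newton-type iteration solve the power flow equations. -/
theorem exists_f_eq_zero {x0 : N.StateIdx → ℝ} {u0 : N.DispIdx → ℝ} {w0 : UncIdx nd → ℝ}
    {Jinv : Matrix N.StateIdx N.EqIdx ℝ} (hJ : N.Jf x0 u0 w0 * Jinv = 1)
    {eg : Envelopes nb ng nl} (heg : N.IsEnvelope (N.resid x0 u0) eg)
    {u : N.DispIdx → ℝ} {zl zu : N.ZIdx → ℝ} {gl gu : BasisIdx nb ng nl → ℝ}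
    (hv : N.VertexBounds eg u zl zu gl gu) (hlim : N.BoxWithinLimits u zl zu) (hz : zl ≤ zu)
    (w : UncIdx nd → ℝ)
    (hself : ∀ g ∈ Set.Icc gl gu,
      N.K Jinv *ᵥ g - (N.A * Jinv * N.R) *ᵥ w ∈ Set.Icc zl zu) :
    ∃ x, N.A *ᵥ x ∈ Set.Icc zl zu ∧ N.f x u w = 0 := by
  -- The state that solves the power flow equations with the residual frozen at `g`.
  let T : (BasisIdx nb ng nl → ℝ) → N.StateIdx → ℝ := fun g =>
    -(Jinv *ᵥ (N.M *ᵥ g + N.R *ᵥ w))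
  have hAT : ∀ g, N.A *ᵥ T g = N.K Jinv *ᵥ g - (N.A * Jinv * N.R) *ᵥ w := fun g => by
    simp only [T, K, mulVec_neg, neg_mulVec, mulVec_add, mulVec_mulVec, Matrix.mul_assoc]
    abel
  have hT : Continuous T := by fun_prop
  obtain ⟨g, hg, hfix⟩ := exists_fixedPoint_of_mapsTo_Icc (heg.lo_le_up hv hlim hz)
    (f := fun g => N.resid x0 u0 (T g) u) ((N.continuous_resid x0 u0 u).comp hT)
    fun g hg => heg.mem_Icc hv hlim (by rw [hAT]; exact hself g hg)
  refine ⟨T g, by rw [hAT]; exact hself g hg, ?_⟩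
  -- At the fixed point the frozen residual is the true one, so `M ψ = M g + J_f (T g) = -R w`.
  have hpsi : N.psi (T g) u = g + N.Jpsi x0 u0 *ᵥ T g := by
    nth_rewrite 2 [← hfix]
    simp [resid]
  have hJT : N.Jf x0 u0 w0 *ᵥ T g = -(N.M *ᵥ g + N.R *ᵥ w) := by
    rw [mulVec_neg, mulVec_mulVec, hJ, one_mulVec]
  rw [f, hpsi, mulVec_add, ← N.Jf_mulVec x0 u0 w0, hJT]
  abel

/-! ### Power balances in terms of the basis functions -/

/-- The active power balance in terms of the basis functions. -/
theorem f_inl (x : N.StateIdx → ℝ) (u : N.DispIdx → ℝ) (w : UncIdx nd → ℝ) (k : Fin nb) :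
    N.f x u w (.inl k) = (N.Cg *ᵥ N.pg x u) k - (N.Cd *ᵥ fun i => w (.inl i)) k -
      (∑ l, N.v x u (N.src l) * N.v x u (N.tgt l) *
        (N.Gc k l * Real.cos (N.phi x l) + N.Bs k l * Real.sin (N.phi x l)) +
      N.Gd k k * N.v x u k ^ 2) := by
  have hd : ∑ j, N.Gd k j * N.v x u j ^ 2 = N.Gd k k * N.v x u k ^ 2 :=
    Finset.sum_eq_single k (fun j _ hj => by simp [Gd, hj.symm]) (by simp)
  have hs : ∑ l, N.v x u (N.src l) * N.v x u (N.tgt l) *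
        (N.Gc k l * Real.cos (N.phi x l) + N.Bs k l * Real.sin (N.phi x l)) =
      ∑ l, N.Gc k l * (N.v x u (N.src l) * N.v x u (N.tgt l) * Real.cos (N.phi x l)) +
      ∑ l, N.Bs k l * (N.v x u (N.src l) * N.v x u (N.tgt l) * Real.sin (N.phi x l)) := by
    rw [← Finset.sum_add_distrib]
    exact Finset.sum_congr rfl fun l _ => by ring
  rw [← hd, hs]
  simp [f, M, R, mulVec, dotProduct, Fintype.sum_sum_type, psi, Finset.sum_neg_distrib]
  ring

/-- The reactive power injection at bus `k`. -/
noncomputable def reactive (x : N.StateIdx → ℝ) (u : N.DispIdx → ℝ) (k : Fin nb) : ℝ :=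
  ∑ l, N.v x u (N.src l) * N.v x u (N.tgt l) *
    (N.Gs k l * Real.sin (N.phi x l) - N.Bc k l * Real.cos (N.phi x l)) -
  N.Bd k k * N.v x u k ^ 2

theorem reactive_eq (x : N.StateIdx → ℝ) (u : N.DispIdx → ℝ) (k : Fin nb) :
    N.reactive x u k =
      -∑ l, N.Bc k l * (N.v x u (N.src l) * N.v x u (N.tgt l) * Real.cos (N.phi x l)) +
      ∑ l, N.Gs k l * (N.v x u (N.src l) * N.v x u (N.tgt l) * Real.sin (N.phi x l)) -
      ∑ j, N.Bd k j * N.v x u j ^ 2 := by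
  have hd : ∑ j, N.Bd k j * N.v x u j ^ 2 = N.Bd k k * N.v x u k ^ 2 :=
    Finset.sum_eq_single k (fun j _ hj => by simp [Bd, hj.symm]) (by simp)
  rw [reactive, hd, ← Finset.sum_neg_distrib, ← Finset.sum_add_distrib]
  congr 1
  exact Finset.sum_congr rfl fun l _ => by ring

/-- A PQ bus has no generator, so `f = 0` there is the full reactive balance with zero generation.
-/
theorem f_inr (x : N.StateIdx → ℝ) (u : N.DispIdx → ℝ) (w : UncIdx nd → ℝ) (k : N.PQBus) :
    N.f x u w (.inr k) = -(N.Cd *ᵥ fun i => w (.inr i)) k - N.reactive x u k := by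
  rw [reactive_eq]
  simp [f, M, R, mulVec, dotProduct, Fintype.sum_sum_type, psi, Finset.sum_neg_distrib]
  ring

theorem Lq_mulVec_psi (x : N.StateIdx → ℝ) (u : N.DispIdx → ℝ) (k : N.PVBus) :
    (N.Lq *ᵥ N.psi x u) k = N.reactive x u k := by
  rw [reactive_eq]
  simp [Lq, mulVec, dotProduct, Fintype.sum_sum_type, psi, Finset.sum_neg_distrib]
  ring

/-! ### Reactive dispatch and robust feasibility -/

/-- Reactive generations within limits can be distributed over the generators of each bus. -/
theorem exists_reactive_dispatch (d : Fin nb → ℝ)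
    (hpv : ∀ k : N.PVBus, (N.Cg *ᵥ N.qMin) k ≤ d k ∧ d k ≤ (N.Cg *ᵥ N.qMax) k)
    (hpq : ∀ k : N.PQBus, d k = 0) :
    ∃ qg : Fin ng → ℝ, (∀ i, N.qMin i ≤ qg i ∧ qg i ≤ N.qMax i) ∧ N.Cg *ᵥ qg = d := by
  -- All generators of a bus run at the same fraction `t` of their ranges. The intermediate value
  -- theorem supplies `t` without a division, so coinciding limits need no separate case.
  have hex : ∀ k : Fin nb, ∃ t ∈ Set.Icc (0 : ℝ) 1,
      (N.Cg *ᵥ N.qMin) k + t * ((N.Cg *ᵥ N.qMax) k - (N.Cg *ᵥ N.qMin) k) = d k := by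
    intro k
    by_cases hk : ∃ i, N.genBus i = k
    · have hcont : Continuous fun t : ℝ =>
        (N.Cg *ᵥ N.qMin) k + t * ((N.Cg *ᵥ N.qMax) k - (N.Cg *ᵥ N.qMin) k) := by fun_prop
      exact intermediate_value_Icc zero_le_one hcont.continuousOn (by simpa using hpv ⟨k, hk⟩)
    · have hzero : ∀ q : Fin ng → ℝ, (N.Cg *ᵥ q) k = 0 := fun q => by
        simp only [mulVec, dotProduct]
        exact Finset.sum_eq_zero fun i _ => by
          simp [Cg, show N.genBus i ≠ k from fun h => hk ⟨i, h⟩]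
      exact ⟨0, by simp, by rw [hzero, hzero, hpq ⟨k, hk⟩]; ring⟩
  choose t ht htd using hex
  refine ⟨fun i => N.qMin i + t (N.genBus i) * (N.qMax i - N.qMin i), fun i => ?_,
    funext fun k => ?_⟩
  · have h1 := sub_nonneg.2 (N.qMin_le_qMax i)
    have h2 := mul_nonneg (ht (N.genBus i)).1 h1
    have h3 := mul_le_of_le_one_left h1 (ht (N.genBus i)).2
    constructor <;> linarith
  · rw [← htd k]
    simp only [mulVec, dotProduct, Cg, ← Finset.sum_sub_distrib, Finset.mul_sum,
      ← Finset.sum_add_distrib]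
    refine Finset.sum_congr rfl fun i _ => ?_
    split_ifs with h
    · rw [h]; ring
    · ring

theorem Cg_mulVec_mono {q q' : Fin ng → ℝ} (h : ∀ i, q i ≤ q' i) (k : Fin nb) :
    (N.Cg *ᵥ q) k ≤ (N.Cg *ᵥ q') k := by
  simp only [mulVec, dotProduct]
  refine Finset.sum_le_sum fun i _ => mul_le_mul_of_nonneg_left (h i) ?_
  unfold Cg
  split_ifs <;> norm_num

theorem robustlyFeasible_of_robustCondition {w0 : UncIdx nd → ℝ}
    {Sig S : Matrix (UncIdx nd) (UncIdx nd) ℝ} (hSig : Sig.PosDef) (hS : Sig = S * Sᵀ)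
    {x0 : N.StateIdx → ℝ} {u0 : N.DispIdx → ℝ} {Jinv : Matrix N.StateIdx N.EqIdx ℝ}
    (hJ : N.Jf x0 u0 w0 * Jinv = 1) {eg eψ : Envelopes nb ng nl}
    (heg : N.IsEnvelope (N.resid x0 u0) eg) (heψ : N.IsEnvelope N.psi eψ)
    {y : N.Var → ℝ} (hγ : 0 ≤ y .gamma) (hy : N.RobustCondition Jinv w0 S eg eψ y) :
    N.RobustlyFeasible w0 Sig (fun j => y (.u j)) (y .gamma) := by
  intro w hw
  have hlim : N.BoxWithinLimits (fun j => y (.u j)) (fun j => y (.zl j)) (fun j => y (.zu j)) :=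
    ⟨hy.p_lower, hy.p_upper, hy.vpq_lower, hy.vpq_upper, hy.vg_lower, hy.vg_upper, hy.phi_lower,
      hy.phi_upper⟩
  obtain ⟨x, hx, hf⟩ := N.exists_f_eq_zero hJ heg hy.resid_bounds hlim hy.ordered w (by
    intro g hg
    -- Over the ellipsoid, `-A J_f⁻¹ R w` stays between `ξ^ℓ(γ)` and `ξ^u(γ)`.
    have hwb := abs_mulVec_sub_le_of_mem_ellipsoid hSig hS hγ hw (N.A * Jinv * N.R)
    simp only [mulVec_sub, Pi.sub_apply, abs_le] at hwb
    constructor <;> intro j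
    · have h1 := hy.self_map_lower j
      have h2 := posEntries_add_negEntries_le_mulVec (N.K Jinv) hg j
      have h3 := (hwb j).2
      simp only [xi, Pi.sub_apply] at h1 ⊢
      linarith
    · have h1 := hy.self_map_upper j
      have h2 := mulVec_le_posEntries_add_negEntries (N.K Jinv) hg j
      have h3 := (hwb j).1
      simp only [xi, Pi.sub_apply] at h1 ⊢
      linarith)
  have hr : ∀ j, x (.inr j) ∈ Set.Icc (y (.zl (.inr j))) (y (.zu (.inr j))) := fun j => by
    rw [← N.A_mulVec_inr x j]
    exact ⟨hx.1 _, hx.2 _⟩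
  have hφ : ∀ l, N.phi x l ∈ Set.Icc (y (.zl (.inl l))) (y (.zu (.inl l))) := fun l => by
    rw [← N.A_mulVec_inl x l]
    exact ⟨hx.1 _, hx.2 _⟩
  have hψ := heψ.mem_Icc hy.basis_bounds hlim hx
  -- The reactive loads at PV buses as a linear map of all of `w`, so that the ellipsoid bound
  -- applies; `Cq * S` involves only the reactive rows of `S`.
  let Cq : Matrix N.PVBus (UncIdx nd) ℝ := fromCols 0 (N.Cd.submatrix Subtype.val id)
  have hCq : ∀ (w' : UncIdx nd → ℝ) (k : N.PVBus),
      (Cq *ᵥ w') k = (N.Cd *ᵥ fun i => w' (.inr i)) k := fun w' k => by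
    simp [Cq, mulVec, dotProduct, Fintype.sum_sum_type]
  have hCS : Cq * S = N.Cd.submatrix (Subtype.val : N.PVBus → Fin nb) id *
      S.submatrix (Sum.inr : Fin nd → UncIdx nd) id := by
    ext k j
    simp [Cq, Matrix.mul_apply, Fintype.sum_sum_type]
  have hζ : ∀ (γ : ℝ) (k : N.PVBus),
      N.zeta w0 S γ k = (N.Cd *ᵥ fun i => w0 (.inr i)) k + γ * rowNorm (Cq * S) k := fun γ k => by
    rw [hCS]
    rfl
  have hwq : ∀ k : N.PVBus, _ := fun k =>
    abs_le.1 (abs_mulVec_sub_le_of_mem_ellipsoid hSig hS hγ hw Cq k)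
  simp only [mulVec_sub] at hwq
  simp only [Pi.sub_apply, hCq] at hwq
  -- The generation each bus must supply is its injection plus its load; at PQ buses this is zero by
  -- `f = 0`.
  obtain ⟨qg, hqg, hqd⟩ := N.exists_reactive_dispatch
    (fun k => N.reactive x (fun j => y (.u j)) k + (N.Cd *ᵥ fun i => w (.inr i)) k)
    (fun k => by
      rw [← Lq_mulVec_psi]
      have h1 := posEntries_add_negEntries_le_mulVec N.Lq hψ k
      have h2 := mulVec_le_posEntries_add_negEntries N.Lq hψ k
      have h3 := hy.reactive_lower k
      have h4 := hy.reactive_upper k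
      -- The bounds `q^ℓ`, `q^u` are relaxed to the generator limits before splitting, because the
      -- condition does not order them.
      have h5 := N.Cg_mulVec_mono hy.q_lower k
      have h6 := N.Cg_mulVec_mono hy.q_upper k
      have h7 := hwq k
      rw [hζ] at h3 h4
      constructor <;> linarith)
    fun k => by
      have h := congrFun hf (.inr k)
      rw [f_inr, Pi.zero_apply] at h
      linarith
  -- The two flow constraints bound the absolute value of the flow, so the squares compare without a
  -- sign assumption on `s`.
  have hflow : ∀ c l, N.flow x (fun j => y (.u j)) c l ^ 2 ≤ y (.s c l) ^ 2 := fun c l => by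
    have h1 := posEntries_add_negEntries_le_mulVec (N.Lline c) hψ l
    have h2 := mulVec_le_posEntries_add_negEntries (N.Lline c) hψ l
    have h3 := hy.flow_upper c l
    have h4 := hy.flow_lower c l
    refine sq_le_sq' ?_ (h2.trans h3)
    unfold flow
    linarith
  refine ⟨x, qg, ⟨fun k => ?_, fun k => ?_⟩, ⟨hlim.pg_mem hr, hqg, hlim.v_mem hr,
    fun l => hlim.phi_mem (hφ l), fun l => ?_, fun l => ?_⟩⟩
  · have h := congrFun hf (.inl k)
    rw [f_inl, Pi.zero_apply, sub_eq_zero] at h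
    exact h
  · rw [hqd]
    exact add_sub_cancel_right _ _
  · exact (add_le_add (hflow .pf l) (hflow .qf l)).trans (hy.line_f l)
  · exact (add_le_add (hflow .pt l) (hflow .qt l)).trans (hy.line_t l)

end PowerNetwork

theorem theorem2 {nb ng nd nl : ℕ} (N : PowerNetwork nb ng nd nl)
    (w0 : UncIdx nd → ℝ) (Sig : Matrix (UncIdx nd) (UncIdx nd) ℝ) (hSig : Sig.PosDef)
    (S : Matrix (UncIdx nd) (UncIdx nd) ℝ) (hS : Sig = S * S.transpose)
    (x0 : N.StateIdx → ℝ) (u0 : N.DispIdx → ℝ)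
    (Jinv : Matrix N.StateIdx N.EqIdx ℝ)
    (hJ : N.Jf x0 u0 w0 * Jinv = 1) (hJ' : Jinv * N.Jf x0 u0 w0 = 1)
    (eg eψ : Envelopes nb ng nl)
    (heg : N.IsEnvelope (N.resid x0 u0) eg) (heψ : N.IsEnvelope N.psi eψ) :
    (∀ (u : N.DispIdx → ℝ) (γ : ℝ), 0 ≤ γ →
      (∃ y : N.Var → ℝ, (∀ j, y (.u j) = u j) ∧ y .gamma = γ ∧
        N.RobustCondition Jinv w0 S eg eψ y) →
      N.RobustlyFeasible w0 Sig u γ) ∧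
    (∃ (m : ℕ) (F : Fin m → (N.Var → ℝ) → ℝ),
      (∀ y, N.RobustCondition Jinv w0 S eg eψ y ↔ ∀ c, F c y ≤ 0) ∧
      (∀ c, ConvexOn ℝ Set.univ (F c)) ∧
      (eg.IsQuadratic → eψ.IsQuadratic → ∀ c, IsQuadraticFun (F c))) := by
  refine ⟨?_, ?_⟩
  · rintro u γ hγ ⟨y, hu, rfl, hy⟩
    rw [show u = fun j => y (.u j) from funext fun j => (hu j).symm]
    exact N.robustlyFeasible_of_robustCondition hSig hS hJ heg heψ hγ hy
  · obtain ⟨ι, _, F, hF, hc, hq⟩ := N.isConvexSystem_robustCondition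
      (H := eg.IsQuadratic ∧ eψ.IsQuadratic) Jinv w0 S heg heψ And.left And.right
    obtain ⟨m, ⟨σ⟩⟩ := Finite.exists_equiv_fin ι
    refine ⟨m, fun c => F (σ.symm c), fun y => ?_, fun c => hc _, fun h h' c => hq ⟨h, h'⟩ _⟩
    exact (hF y).trans (σ.symm.forall_congr_right (q := fun c => F c y ≤ 0)).symm
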